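/- For $n\ge 1$ let $\mathbb{T}^n=\mathbb{R}^n/(2\pi\mathbb{Z})^n$ be the torus with its Euclidean metric, $\Delta$ its Laplacian and $dx$ its Lebesgue measure (of total mass $(2\pi)^n$). (1) Let $n\ge 2$ and let $\omega\subset\mathbb{T}^n$ be a nonempty open set. Then there exists a constant $c_\omega>0$ such that, for every $\lambda\ge 0$ and every smooth function $\psi_\lambda:\mathbb{T}^n\to\mathbb{C}$ with $$-\Delta\psi_\lambda=\lambda^2\psi_\lambda,\qquad \|\psi_\lambda\|_{L^2(\mathbb{T}^n)}=1,$$ one has $$\int_\omega|\psi_\lambda(x)|^2\,dx\ \ge\ c_\omega .$$ (2) For $h>0$ and $a\in C_c^\infty(T^*\mathbb{T}^2)$, where $T^*\mathbb{T}^2=\mathbb{T}^2\times\mathbb{R}^2$, let $$\mathrm{Op}_h(a)u(x)=\frac{1}{(2\pi h)^2}\int_{\mathbb{R}^2}\int_{\mathbb{R}^2}a\Big(\frac{x+y}{2},\xi\Big)e^{\frac{i}{h}\langle x-y,\xi\rangle}u(y)\,d\xi\,dy$$ be the Weyl quantization of $a$, acting on $2\pi\mathbb{Z}^2$-periodic functions.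 A semiclassical measure is a distribution $\mu\in\mathcal{D}'(T^*\mathbb{T}^2)$ for which there are $h_j\to0^+$ and smooth $\psi_j$ on $\mathbb{T}^2$ with $-h_j^2\Delta\psi_j=\psi_j$, $\|\psi_j\|_{L^2}=1$ and $$\langle\psi_j,\mathrm{Op}_{h_j}(a)\psi_j\rangle_{L^2(\mathbb{T}^2)}\longrightarrow\langle\mu,a\rangle\qquad\text{for every }a\in C_c^\infty(T^*\mathbb{T}^2).$$ Let $\mathcal{M}(\Delta)$ be the set of all semiclassical measures, and let $\omega\subset\mathbb{T}^2$ be a nonempty open set. Then there exists a constant $c_\omega>0$ such that every $\mu\in\mathcal{M}(\Delta)$ is given by a Borel probability measure on $T^*\mathbb{T}^2$ carried by $\mathbb{T}^2\times\mathbb{S}^1$, and $$\mu(\omega\times\mathbb{S}^1)\ \ge\ c_\omega .$$ -/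

import Mathlib

open MeasureTheory Filter Topology
open scoped ContDiff

noncomputable section

namespace FlatTorus

/-- The circle `ℝ / 2πℤ` has positive length. -/
instance factTwoPiPos : Fact (0 < 2 * Real.pi) := ⟨Real.two_pi_pos⟩

/-- Euclidean space `ℝⁿ`. -/
abbrev Euc (n : ℕ) : Type := EuclideanSpace ℝ (Fin n)

/-- The torus `𝕋ⁿ = ℝⁿ / (2πℤ)ⁿ`.  Its `volume` is the product of the arc length measures, of
total mass `(2π)ⁿ`. -/
abbrev Torus (n : ℕ) : Type := Fin n → AddCircle (2 * Real.pi)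

/-- The cotangent bundle `T*𝕋ⁿ = 𝕋ⁿ × ℝⁿ`. -/
abbrev Cotangent (n : ℕ) : Type := Torus n × Euc n

/-- The projection `ℝⁿ → 𝕋ⁿ`, a local isometry for the flat metric. -/
def proj {n : ℕ} (x : Euc n) : Torus n := fun i => (x i : AddCircle (2 * Real.pi))

/-- The `2πℤⁿ`-periodic function on `ℝⁿ` given by a function on the torus. -/
def lift {n : ℕ} (ψ : Torus n → ℂ) : Euc n → ℂ := fun x => ψ (proj x)

/-- `ψ` is a smooth function on the flat torus with `-Δψ = lam² ψ` and `‖ψ‖_{L²} = 1`. -/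
structure IsNormalizedEigenfunction {n : ℕ} (lam : ℝ) (ψ : Torus n → ℂ) : Prop where
  smooth : ContDiff ℝ ∞ (lift ψ)
  eigen : ∀ x : Euc n, -(Laplacian.laplacian (lift ψ) x) = (lam : ℂ) ^ 2 * lift ψ x
  normalized : ∫ x : Torus n, ‖ψ x‖ ^ 2 = 1

/-- A function on `T*𝕋ⁿ`, seen as a function on `ℝⁿ × ℝⁿ` periodic in the first variable. -/
def liftSymbol {n : ℕ} (a : Cotangent n → ℂ) : Euc n × Euc n → ℂ := fun p => a (proj p.1, p.2)

/-- The space `C_c^∞(T*𝕋ⁿ)` of smooth compactly supported symbols. -/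
def TestFunctions (n : ℕ) : Submodule ℂ (Cotangent n → ℂ) where
  carrier := {a | ContDiff ℝ ∞ (liftSymbol a) ∧ HasCompactSupport a}
  zero_mem' := ⟨contDiff_const, HasCompactSupport.zero⟩
  add_mem' := fun ha hb => ⟨ha.1.add hb.1, ha.2.add hb.2⟩
  smul_mem' := fun c _ ha => ⟨contDiff_const.smul ha.1, ha.2.smul_left (f := fun _ => c)⟩

/-- A linear functional on `C_c^∞(T*𝕋ⁿ)` is a distribution if, on the functions supported in
a given compact set, it is bounded by finitely many derivatives. -/
def IsDistribution {n : ℕ} (μ : TestFunctions n →ₗ[ℂ] ℂ) : Prop :=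
  ∀ K : Set (Cotangent n), IsCompact K → ∃ (N : ℕ) (C : ℝ), ∀ a : TestFunctions n,
    tsupport (a : Cotangent n → ℂ) ⊆ K → ∀ B : ℝ,
      (∀ j ≤ N, ∀ p : Euc n × Euc n, ‖iteratedFDeriv ℝ j (liftSymbol a) p‖ ≤ B) → ‖μ a‖ ≤ C * B

/-- The Weyl quantization
`Op_h(a)u(x) = (2πh)⁻ⁿ ∬ a((x+y)/2, ξ) exp(i⟨x-y,ξ⟩/h) u(y) dξ dy`
of a symbol on `T*𝕋ⁿ`, acting on periodic functions on `ℝⁿ`.  For `a` in `C_c^∞(T*𝕋ⁿ)`, the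
integral over `ξ` is rapidly decreasing in `x - y`, so both integrals converge absolutely. -/
def weylOp {n : ℕ} (h : ℝ) (a : Cotangent n → ℂ) (u : Euc n → ℂ) (x : Euc n) : ℂ :=
  (((2 * Real.pi * h) ^ n)⁻¹ : ℝ) *
    ∫ y : Euc n,
      (∫ ξ : Euc n, a (proj ((1 / 2 : ℝ) • (x + y)), ξ) *
        Complex.exp (Complex.I * ((inner ℝ (x - y) ξ / h : ℝ) : ℂ))) * u y

/-- The fundamental domain `(0, 2π]ⁿ` of the torus. -/
def box (n : ℕ) : Set (Euc n) := {x | ∀ i, x i ∈ Set.Ioc 0 (2 * Real.pi)}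

/-- The Wigner distribution `a ↦ ⟨ψ, Op_h(a)ψ⟩` of `ψ ∈ L²(𝕋ⁿ)`. -/
def wigner {n : ℕ} (h : ℝ) (ψ : Torus n → ℂ) (a : Cotangent n → ℂ) : ℂ :=
  ∫ x in box n, (starRingEnd ℂ) (lift ψ x) * weylOp h a (lift ψ) x

/-- The set `M(Δ)` of semiclassical measures of the flat torus: the distributions on `T*𝕋ⁿ` that
are limits of the Wigner distributions of normalized solutions of `-h²Δψ = ψ`, along a
sequence `h → 0⁺`. -/
def semiclassicalMeasures (n : ℕ) : Set (TestFunctions n →ₗ[ℂ] ℂ) :=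
  {μ | IsDistribution μ ∧ ∃ (h : ℕ → ℝ) (ψ : ℕ → Torus n → ℂ),
    (∀ j, 0 < h j) ∧ Tendsto h atTop (𝓝 0) ∧
    (∀ j, IsNormalizedEigenfunction (h j)⁻¹ (ψ j)) ∧
    ∀ a : TestFunctions n, Tendsto (fun j => wigner (h j) (ψ j) a) atTop (𝓝 (μ a))}

/-- The Borel probability measure `m` on `T*𝕋ⁿ` is carried by the unit cosphere bundle
`S*𝕋ⁿ = 𝕋ⁿ × 𝕊ⁿ⁻¹` and represents the distribution `μ`. -/
structure Represents {n : ℕ} (m : Measure (Cotangent n)) (μ : TestFunctions n →ₗ[ℂ] ℂ) :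
    Prop where
  probability : IsProbabilityMeasure m
  carried : m (Set.univ ×ˢ Metric.sphere (0 : Euc n) 1)ᶜ = 0
  integral_eq : ∀ a : TestFunctions n, μ a = ∫ z, (a : Cotangent n → ℂ) z ∂m

end FlatTorus

end

/-!
An eigenfunction with eigenvalue `λ²` is a trigonometric polynomial with frequencies on the sphere
of radius `λ`. Cut these frequencies into clusters, the connected components of the relation
`dist k l ≤ M`. A continuous weight is approximately a trigonometric polynomial of degree `M`, so
it nearly decouples the clusters. The diameter of a cluster is bounded in terms of `M` and `n`
only: finitely many bounded configurations of lattice points exist up to translation, and each one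
determines the section of the sphere by its affine span. The same remark confines all the
frequencies to a bounded region as soon as some cluster has the same affine span as the whole set.
Hence, by induction on the dimension of the affine span, observability reduces to boundedly many
frequencies up to translation, where it follows from compactness and unique continuation.

For semiclassical measures, the Wigner distribution is a sum over pairs of frequencies `(k, l)`,
with momentum `h (k + l) / 2`. Let `M` tend to infinity slowly as `h → 0`: only pairs in a common
cluster matter, and their momentum may be replaced by `h` times a fixed point of the cluster. So
the Wigner distributions are asymptotic to sums of position densities of clusters, each placed at a
single momentum of the unit sphere. These are probability measures on a compact space, and the
observability inequality, applied cluster by cluster, passes to their limits.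
-/

noncomputable section

namespace FlatTorus

open scoped ComplexConjugate

section Torus

variable {n : ℕ}

lemma proj_add (x y : Euc n) : proj (x + y) = proj x + proj y := by
  funext i; simp [proj]

lemma proj_sub (x y : Euc n) : proj (x - y) = proj x - proj y := by
  funext i; simp [proj]

@[fun_prop]
lemma continuous_proj : Continuous (proj (n := n)) :=
  continuous_pi fun i => (AddCircle.continuous_mk' _).comp (PiLp.continuous_apply 2 _ i)

lemma isOpenMap_proj : IsOpenMap (proj (n := n)) := by
  have h : IsOpenMap (fun (x : Fin n → ℝ) (i : Fin n) => (x i : AddCircle (2 * Real.pi))) :=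
    IsOpenMap.piMap (fun _ => QuotientAddGroup.isOpenMap_coe)
      (Eventually.of_forall fun _ => QuotientAddGroup.mk_surjective)
  exact h.comp (EuclideanSpace.equiv (Fin n) ℝ).toHomeomorph.isOpenMap

/-- The representative of a point of the torus in the fundamental domain `box n`. -/
def rep (x : Torus n) : Euc n :=
  WithLp.toLp 2 fun i => (AddCircle.equivIoc (2 * Real.pi) 0 (x i) : ℝ)

@[simp] lemma proj_rep (x : Torus n) : proj (rep x) = x :=
  funext fun i => (AddCircle.equivIoc (2 * Real.pi) 0).symm_apply_apply (x i)

lemma proj_surjective : Function.Surjective (proj (n := n)) := fun x => ⟨rep x, proj_rep x⟩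

lemma isQuotientMap_proj : IsQuotientMap (proj (n := n)) :=
  isOpenMap_proj.isQuotientMap continuous_proj proj_surjective

lemma measurePreserving_proj :
    MeasurePreserving (proj (n := n)) (volume.restrict (box n)) volume := by
  have hcoe : MeasurePreserving
      (fun (x : Fin n → ℝ) (i : Fin n) => (x i : AddCircle (2 * Real.pi)))
      (Measure.pi fun _ : Fin n => (volume : Measure ℝ).restrict (Set.Ioc 0 (2 * Real.pi)))
      (Measure.pi fun _ => volume) := by
    refine measurePreserving_pi _ _ fun _ => ?_
    simpa only [zero_add] using AddCircle.measurePreserving_mk (2 * Real.pi) 0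
  have hequiv :=
    (EuclideanSpace.volume_preserving_symm_measurableEquiv_toLp (Fin n)).restrict_preimage
      (s := Set.univ.pi fun _ : Fin n => Set.Ioc 0 (2 * Real.pi))
      (MeasurableSet.univ_pi fun _ => measurableSet_Ioc)
  rw [volume_pi, Measure.restrict_pi_pi] at hequiv
  have hbox : box n = (MeasurableEquiv.toLp 2 (Fin n → ℝ)).symm ⁻¹'
      Set.univ.pi fun _ => Set.Ioc 0 (2 * Real.pi) := by
    ext x; simp [box, Set.mem_pi]
  rw [hbox]
  exact hcoe.comp hequiv

lemma setIntegral_box_proj {f : Torus n → ℂ} (hf : AEStronglyMeasurable f) :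
    ∫ x in box n, f (proj x) = ∫ x, f x := by
  rw [← measurePreserving_proj.map_eq] at hf ⊢
  rw [integral_map continuous_proj.aemeasurable hf]

lemma volume_real_univ : (volume : Measure (Torus n)).real Set.univ = (2 * Real.pi) ^ n := by
  simp [measureReal_def, volume_pi, Measure.pi_univ, AddCircle.measure_univ,
    ENNReal.toReal_ofReal Real.pi_pos.le]

lemma integrable_of_continuous {X E : Type*} [TopologicalSpace X] [CompactSpace X]
    [MeasurableSpace X] [OpensMeasurableSpace X] [NormedAddCommGroup E]
    {μ : Measure X} [IsFiniteMeasureOnCompacts μ] {f : X → E} (hf : Continuous f) :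
    Integrable f μ :=
  hf.integrable_of_hasCompactSupport (HasCompactSupport.of_compactSpace f)

end Torus

section Lattice

variable {n : ℕ}

/-- The inclusion of the lattice `ℤⁿ` of frequencies in `ℝⁿ`. -/
def toEuc : (Fin n → ℤ) →+ Euc n where
  toFun k := WithLp.toLp 2 fun i => (k i : ℝ)
  map_zero' := by ext i; simp
  map_add' k l := by ext i; simp

@[simp] lemma toEuc_apply (k : Fin n → ℤ) (i : Fin n) : toEuc k i = k i := rfl

lemma dist_toEuc (k l : Fin n → ℤ) : dist (toEuc k) (toEuc l) = ‖toEuc (k - l)‖ := by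
  rw [dist_eq_norm, map_sub]

lemma abs_coord_le_norm_toEuc (k : Fin n → ℤ) (i : Fin n) : |(k i : ℝ)| ≤ ‖toEuc k‖ := by
  simpa using PiLp.norm_apply_le (toEuc k) i

lemma finite_norm_toEuc_le (r : ℝ) : {k : Fin n → ℤ | ‖toEuc k‖ ≤ r}.Finite := by
  refine (Set.finite_Icc (fun _ : Fin n => -⌊r⌋) fun _ => ⌊r⌋).subset fun k hk => ?_
  have hcoord : ∀ i, |k i| ≤ ⌊r⌋ := fun i =>
    Int.le_floor.2 (by simpa using (abs_coord_le_norm_toEuc k i).trans hk)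
  exact ⟨fun i => (abs_le.1 (hcoord i)).1, fun i => (abs_le.1 (hcoord i)).2⟩

variable (n) in
/-- The lattice points of norm at most `r`. -/
def latticeBall (r : ℝ) : Finset (Fin n → ℤ) := (finite_norm_toEuc_le r).toFinset

@[simp] lemma mem_latticeBall {r : ℝ} {k : Fin n → ℤ} :
    k ∈ latticeBall n r ↔ ‖toEuc k‖ ≤ r := by
  simp [latticeBall]

end Lattice

section Modes

variable {n : ℕ}

/-- The Fourier mode `x ↦ exp(i⟨k,x⟩)` on the torus. -/
def mode (k : Fin n → ℤ) : C(Torus n, ℂ) where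
  toFun x := ∏ i, fourier (k i) (x i)
  continuous_toFun := by fun_prop

lemma mode_apply (k : Fin n → ℤ) (x : Torus n) : mode k x = ∏ i, fourier (k i) (x i) := rfl

lemma mode_add (k l : Fin n → ℤ) (x : Torus n) : mode (k + l) x = mode k x * mode l x := by
  simp only [mode_apply, Pi.add_apply, fourier_add, Finset.prod_mul_distrib]

lemma mode_neg (k : Fin n → ℤ) (x : Torus n) : mode (-k) x = conj (mode k x) := by
  simp only [mode_apply, Pi.neg_apply, fourier_neg, map_prod]

lemma mode_sub (k l : Fin n → ℤ) (x : Torus n) : mode (k - l) x = mode k x * conj (mode l x) := by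
  rw [sub_eq_add_neg, mode_add, mode_neg]

@[simp] lemma mode_zero (x : Torus n) : mode (0 : Fin n → ℤ) x = 1 := by
  simp [mode_apply]

@[simp] lemma norm_mode (k : Fin n → ℤ) (x : Torus n) : ‖mode k x‖ = 1 := by
  simp [mode_apply, norm_prod, fourier_apply, Circle.norm_coe]

lemma mode_apply_add (k : Fin n → ℤ) (x y : Torus n) :
    mode k (x + y) = mode k x * mode k y := by
  simp only [mode_apply, Pi.add_apply, ← Finset.prod_mul_distrib]
  refine Finset.prod_congr rfl fun i _ => ?_
  simp [fourier_apply, smul_add, AddCircle.toCircle_add]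

lemma mode_proj (k : Fin n → ℤ) (x : Euc n) :
    mode k (proj x) = Complex.exp (Complex.I * ((inner ℝ (toEuc k) x : ℝ) : ℂ)) := by
  simp only [mode_apply, proj, fourier_coe_apply, ← Complex.exp_sum]
  rw [PiLp.inner_apply, Complex.ofReal_sum, Finset.mul_sum]
  congr 1
  refine Finset.sum_congr rfl fun i _ => ?_
  have : (Real.pi : ℂ) ≠ 0 := by exact_mod_cast Real.pi_ne_zero
  simp
  field_simp

lemma integral_mode_of_ne_zero {k : Fin n → ℤ} (hk : k ≠ 0) : ∫ x, mode k x = 0 := by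
  obtain ⟨i, hi⟩ : ∃ i, k i ≠ 0 := Function.ne_iff.1 hk
  let y : Euc n := EuclideanSpace.single i (Real.pi / k i)
  have hy : inner ℝ (toEuc k) y = Real.pi := by
    rw [EuclideanSpace.inner_single_right]
    simp
    field_simp
  have hhalf : mode k (proj y) = -1 := by
    rw [mode_proj, hy, mul_comm, Complex.exp_pi_mul_I]
  refine integral_eq_zero_of_add_right_eq_neg (g := proj y) fun x => ?_
  rw [mode_apply_add, hhalf, mul_neg_one]

lemma integral_mode (k : Fin n → ℤ) :
    ∫ x, mode k x = if k = 0 then ((2 * Real.pi) ^ n : ℂ) else 0 := by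
  split_ifs with h
  · simp [h, volume_real_univ]
  · exact integral_mode_of_ne_zero h

/-- The Fourier coefficient of a function on the torus, without the factor `(2π)⁻ⁿ`. -/
def coeff (f : Torus n → ℂ) (m : Fin n → ℤ) : ℂ := ∫ x, mode (-m) x * f x

lemma norm_coeff_le {f : Torus n → ℂ} {C : ℝ} (hC : ∀ x, ‖f x‖ ≤ C) (m : Fin n → ℤ) :
    ‖coeff f m‖ ≤ C * (2 * Real.pi) ^ n := by
  rw [← volume_real_univ]
  exact norm_integral_le_of_norm_le_const (Eventually.of_forall fun x => by simpa using hC x)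

/-- The trigonometric polynomial `∑_{k ∈ S} c_k exp(i⟨k,x⟩)`. -/
def trigPoly (S : Finset (Fin n → ℤ)) (c : (Fin n → ℤ) → ℂ) : C(Torus n, ℂ) :=
  ∑ k ∈ S, c k • mode k

lemma trigPoly_apply (S : Finset (Fin n → ℤ)) (c : (Fin n → ℤ) → ℂ) (x : Torus n) :
    trigPoly S c x = ∑ k ∈ S, c k * mode k x := by
  simp [trigPoly]

lemma coeff_trigPoly (S : Finset (Fin n → ℤ)) (c : (Fin n → ℤ) → ℂ)
    (m : Fin n → ℤ) :
    coeff (trigPoly S c) m = if m ∈ S then (2 * Real.pi) ^ n * c m else 0 := by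
  have hmode : ∀ (k : Fin n → ℤ) (x : Torus n),
      mode (-m) x * (c k * mode k x) = c k * mode (k - m) x := fun k x => by
    rw [sub_eq_add_neg, mode_add]; ring
  simp only [coeff, trigPoly_apply, Finset.mul_sum, hmode]
  rw [integral_finsetSum _ fun k _ => integrable_of_continuous (by fun_prop)]
  simp only [integral_const_mul, integral_mode, sub_eq_zero, mul_ite, mul_zero,
    Finset.sum_ite_eq', mul_comm (c m)]

/-- The change of period from `2π` to `1`, which gives access to Mathlib's multiple Fourier
series. -/
def rescale : UnitAddTorus (Fin n) ≃ₜ Torus n :=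
  Homeomorph.piCongrRight fun _ =>
    AddCircle.homeomorphAddCircle 1 (2 * Real.pi) one_ne_zero Real.two_pi_pos.ne'

lemma mode_rescale (k : Fin n → ℤ) (t : UnitAddTorus (Fin n)) :
    mode k (rescale t) = UnitAddTorus.mFourier k t := by
  change ∏ i, fourier (k i) (AddCircle.homeomorphAddCircle 1 (2 * Real.pi) one_ne_zero
    Real.two_pi_pos.ne' (t i)) = ∏ i, fourier (k i) (t i)
  refine Finset.prod_congr rfl fun i _ => ?_
  induction t i using QuotientAddGroup.induction_on with
  | H s =>
    rw [AddCircle.homeomorphAddCircle_apply_mk, fourier_coe_apply, fourier_coe_apply]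
    have : (Real.pi : ℂ) ≠ 0 := by exact_mod_cast Real.pi_ne_zero
    congr 1
    push_cast
    field_simp

theorem exists_trigPoly_near (f : C(Torus n, ℂ)) {ε : ℝ} (hε : 0 < ε) :
    ∃ (S : Finset (Fin n → ℤ)) (c : (Fin n → ℤ) → ℂ), ∀ x, ‖f x - trigPoly S c x‖ ≤ ε := by
  let g : C(UnitAddTorus (Fin n), ℂ) := f.comp ⟨rescale, rescale.continuous⟩
  have hg : g ∈ (Submodule.span ℂ (Set.range
      (UnitAddTorus.mFourier (d := Fin n)))).topologicalClosure := by
    rw [UnitAddTorus.span_mFourier_closure_eq_top]; trivial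
  obtain ⟨p, hp, hgp⟩ := Metric.mem_closure_iff.1 hg ε hε
  obtain ⟨c, rfl⟩ := Finsupp.mem_span_range_iff_exists_finsupp.1 hp
  refine ⟨c.support, c, fun x => ?_⟩
  have hx := (ContinuousMap.dist_apply_le_dist (rescale.symm x)).trans hgp.le
  simpa [g, dist_eq_norm, trigPoly_apply, Finsupp.sum, ← mode_rescale] using hx

lemma integral_mul_norm_sq_trigPoly {g : Torus n → ℂ} (hg : Continuous g)
    (S : Finset (Fin n → ℤ)) (c : (Fin n → ℤ) → ℂ) :
    ∫ x, g x * (‖trigPoly S c x‖ : ℂ) ^ 2 =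
      ∑ k ∈ S, ∑ l ∈ S, conj (c k) * c l * coeff g (k - l) := by
  have hexpand : ∀ x, g x * (‖trigPoly S c x‖ : ℂ) ^ 2 =
      ∑ k ∈ S, ∑ l ∈ S, conj (c k) * c l * (mode (-(k - l)) x * g x) := fun x => by
    rw [← Complex.conj_mul', trigPoly_apply, map_sum, Finset.sum_mul_sum, Finset.mul_sum]
    refine Finset.sum_congr rfl fun k _ => ?_
    rw [Finset.mul_sum]
    refine Finset.sum_congr rfl fun l _ => ?_
    rw [neg_sub, mode_sub, map_mul]
    ring
  have hint : ∀ k l, Integrable fun x => conj (c k) * c l * (mode (-(k - l)) x * g x) := fun k l =>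
    integrable_of_continuous (by fun_prop)
  simp_rw [hexpand]
  rw [integral_finsetSum _ fun k _ => integrable_finsetSum _ fun l _ => hint k l]
  refine Finset.sum_congr rfl fun k _ => ?_
  rw [integral_finsetSum _ fun l _ => hint k l]
  exact Finset.sum_congr rfl fun l _ => integral_const_mul _ _

lemma integral_norm_sq_trigPoly (S : Finset (Fin n → ℤ)) (c : (Fin n → ℤ) → ℂ) :
    ∫ x, ‖trigPoly S c x‖ ^ 2 = (2 * Real.pi) ^ n * ∑ k ∈ S, ‖c k‖ ^ 2 := by
  apply Complex.ofReal_injective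
  have h := integral_mul_norm_sq_trigPoly (g := fun _ => 1) continuous_const S c
  simp only [one_mul, coeff, mul_one, integral_mode, neg_sub, sub_eq_zero, mul_ite, mul_zero,
    Finset.sum_ite_eq', Complex.conj_mul'] at h
  rw [← integral_complex_ofReal]
  push_cast
  rw [h, Finset.mul_sum]
  exact Finset.sum_congr rfl fun k hk => by rw [if_pos hk, mul_comm]

end Modes

section Clusters

variable {α : Type*} [DecidableEq α] {r : α → α → Prop}

/-- A nonempty finite set is linked by the relation `r` if each way of cutting it into two nonempty
parts leaves two related points on different sides. -/
def Linked (r : α → α → Prop) (K : Finset α) : Prop :=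
  K.Nonempty ∧ ∀ A ⊂ K, A.Nonempty → ∃ x ∈ A, ∃ y ∈ K \ A, r x y

lemma linked_singleton (x : α) : Linked r {x} := by
  refine ⟨Finset.singleton_nonempty x, fun A hA hne => ?_⟩
  rw [Finset.ssubset_singleton_iff.1 hA] at hne
  exact absurd hne Finset.not_nonempty_empty

lemma linked_insert (hr : ∀ x y, r x y → r y x) {K : Finset α} (hK : Linked r K) {x y : α}
    (hx : x ∈ K) (hxy : r x y) : Linked r (insert y K) := by
  refine ⟨Finset.insert_nonempty y K, fun A hA ⟨a, ha⟩ => ?_⟩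
  by_cases hKA : K ⊆ A
  · have hy : y ∉ A := fun hy => hA.2 (Finset.insert_subset hy hKA)
    exact ⟨x, hKA hx, y, by simp [hy], hxy⟩
  by_cases hAK : (A ∩ K).Nonempty
  · have hss : A ∩ K ⊂ K :=
      ⟨Finset.inter_subset_right, fun h => hKA (h.trans Finset.inter_subset_left)⟩
    obtain ⟨u, hu, v, hv, huv⟩ := hK.2 _ hss hAK
    exact ⟨u, Finset.mem_of_mem_inter_left hu, v, by grind, huv⟩
  · have hdisj : ∀ z ∈ A, z ∉ K := fun z hz hzK => hAK ⟨z, Finset.mem_inter.2 ⟨hz, hzK⟩⟩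
    obtain rfl : a = y := (Finset.mem_insert.1 (hA.1 ha)).resolve_right (hdisj a ha)
    exact ⟨a, ha, x, by grind, hr x a hxy⟩

/-- The points of `S` with the label `q`. -/
def cluster (S : Finset α) (κ : α → α) (q : α) : Finset α := S.filter (κ · = q)

@[simp] lemma mem_cluster {S : Finset α} {κ : α → α} {q k : α} :
    k ∈ cluster S κ q ↔ k ∈ S ∧ κ k = q := Finset.mem_filter

lemma cluster_subset (S : Finset α) (κ : α → α) (q : α) : cluster S κ q ⊆ S :=
  Finset.filter_subset _ _

lemma sum_cluster {E : Type*} [AddCommMonoid E] (S : Finset α) (κ : α → α) (f : α → E) :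
    ∑ q ∈ S.image κ, ∑ k ∈ cluster S κ q, f k = ∑ k ∈ S, f k :=
  Finset.sum_fiberwise_of_maps_to (fun _ hk => Finset.mem_image_of_mem κ hk) f

lemma sum_sum_eq_sum_cluster {E : Type*} [AddCommMonoid E] {S : Finset α} {κ : α → α}
    {g : α → α → E} (hg : ∀ k ∈ S, ∀ l ∈ S, κ k ≠ κ l → g k l = 0) :
    ∑ k ∈ S, ∑ l ∈ S, g k l =
      ∑ q ∈ S.image κ, ∑ k ∈ cluster S κ q, ∑ l ∈ cluster S κ q, g k l := by
  rw [← sum_cluster S κ]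
  refine Finset.sum_congr rfl fun q _ => Finset.sum_congr rfl fun k hk => ?_
  obtain ⟨hkS, rfl⟩ := mem_cluster.1 hk
  exact (Finset.sum_subset (cluster_subset S κ _) fun l hl hlq =>
    hg k hkS l hl fun h => hlq (mem_cluster.2 ⟨hl, h.symm⟩)).symm

/-- The labels `κ k`, `k ∈ S`, select one point in each connected component of the relation `r`
on `S`. -/
structure IsClustering (r : α → α → Prop) (S : Finset α) (κ : α → α) : Prop where
  map_map : ∀ k ∈ S, κ (κ k) = κ k
  mem : ∀ k ∈ S, κ k ∈ S
  linked : ∀ k ∈ S, Linked r (cluster S κ (κ k))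
  eq_of_rel : ∀ k ∈ S, ∀ l ∈ S, r k l → κ k = κ l

lemma IsClustering.label_mem_cluster {S : Finset α} {κ : α → α} (h : IsClustering r S κ) {k : α}
    (hk : k ∈ S) : κ k ∈ cluster S κ (κ k) :=
  mem_cluster.2 ⟨h.mem k hk, h.map_map k hk⟩

theorem exists_isClustering (hr : ∀ x y, r x y → r y x) (S : Finset α) :
    ∃ κ, IsClustering r S κ := by
  let s : Setoid α := Relation.EqvGen.setoid fun x y => x ∈ S ∧ y ∈ S ∧ r x y
  have closed : ∀ A : Finset α, (∀ x ∈ S, ∀ y ∈ S, r x y → (x ∈ A ↔ y ∈ A)) →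
      ∀ x y, s x y → (x ∈ A ↔ y ∈ A) := fun A hA x y hxy => by
    induction hxy with
    | rel x y h => exact hA x h.1 y h.2.1 h.2.2
    | refl x => rfl
    | symm x y _ ih => exact ih.symm
    | trans x y z _ _ ih ih' => exact ih.trans ih'
  let κ : α → α := fun k => (Quotient.mk s k).out
  have hκ : ∀ k, s (κ k) k := fun k => Quotient.mk_out k
  have hκ_eq : ∀ {k l}, s k l → κ k = κ l := fun h => congrArg Quotient.out (Quotient.sound h)
  have hlink : ∀ k ∈ S, ∀ l ∈ S, r k l → κ k = κ l := fun k hk l hl h =>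
    hκ_eq (Relation.EqvGen.rel k l ⟨hk, hl, h⟩)
  have hmem : ∀ k ∈ S, κ k ∈ S := fun k hk =>
    (closed S (fun x hx y hy _ => iff_of_true hx hy) _ _ (hκ k)).2 hk
  refine ⟨κ, fun k _ => hκ_eq (hκ k), hmem, fun k hk => ⟨⟨k, by simp [hk]⟩, ?_⟩, hlink⟩
  rintro A hA ⟨a, ha⟩
  by_contra! hsep
  obtain ⟨b, hb, hbA⟩ := Finset.exists_of_ssubset hA
  have hstep : ∀ x ∈ S, ∀ y ∈ S, r x y → x ∈ A → y ∈ A := fun x hx y hy hxy hxA => by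
    by_contra hyA
    have hyk : κ y = κ k := (hlink x hx y hy hxy).symm.trans (mem_cluster.1 (hA.1 hxA)).2
    exact hsep x hxA y (by simp [hy, hyk, hyA]) hxy
  have hab : s a b := by
    have := (mem_cluster.1 (hA.1 ha)).2.trans (mem_cluster.1 hb).2.symm
    exact s.trans (s.symm (hκ a)) (by rw [this]; exact hκ b)
  exact hbA ((closed A (fun x hx y hy hxy =>
    ⟨hstep x hx y hy hxy, hstep y hy x hx (hr x y hxy)⟩) a b hab).1 ha)

end Clusters

section AffineRank

variable {n : ℕ}

/-- The direction of the affine span of a set of lattice points. -/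
def dirSpan (K : Finset (Fin n → ℤ)) : Submodule ℝ (Euc n) :=
  vectorSpan ℝ (toEuc '' (K : Set (Fin n → ℤ)))

lemma dirSpan_mono {K L : Finset (Fin n → ℤ)} (h : K ⊆ L) : dirSpan K ≤ dirSpan L :=
  vectorSpan_mono ℝ (Set.image_mono (Finset.coe_subset.2 h))

lemma sub_mem_dirSpan {K : Finset (Fin n → ℤ)} {x y : Fin n → ℤ} (hx : x ∈ K) (hy : y ∈ K) :
    toEuc x - toEuc y ∈ dirSpan K :=
  vsub_mem_vectorSpan ℝ (Set.mem_image_of_mem _ hx) (Set.mem_image_of_mem _ hy)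

lemma dirSpan_eq_span {K : Finset (Fin n → ℤ)} {x : Fin n → ℤ} (hx : x ∈ K) :
    dirSpan K = Submodule.span ℝ (toEuc '' (K.image (· - x) : Finset (Fin n → ℤ))) := by
  rw [dirSpan, vectorSpan_eq_span_vsub_set_right ℝ (Set.mem_image_of_mem _ (Finset.mem_coe.2 hx))]
  congr 1
  ext y
  simp [map_sub]

/-- The dimension of the affine span of a set of lattice points. -/
def affRank (K : Finset (Fin n → ℤ)) : ℕ := Module.finrank ℝ (dirSpan K)

lemma affRank_mono {K L : Finset (Fin n → ℤ)} (h : K ⊆ L) : affRank K ≤ affRank L :=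
  Submodule.finrank_mono (dirSpan_mono h)

lemma affRank_le (K : Finset (Fin n → ℤ)) : affRank K ≤ n := by
  simpa [affRank] using Submodule.finrank_le (dirSpan K)

lemma affRank_singleton (x : Fin n → ℤ) : affRank {x} = 0 := by
  rw [affRank, dirSpan, Finset.coe_singleton, Set.image_singleton, vectorSpan_singleton,
    finrank_bot]

lemma eq_of_affRank_eq_zero {K : Finset (Fin n → ℤ)} (hK : affRank K = 0) {x y : Fin n → ℤ}
    (hx : x ∈ K) (hy : y ∈ K) : toEuc x = toEuc y := by
  have hbot : dirSpan K = ⊥ := Submodule.finrank_eq_zero.1 hK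
  simpa [hbot, sub_eq_zero] using sub_mem_dirSpan hx hy

lemma Linked.exists_lt_affRank_insert {r : (Fin n → ℤ) → (Fin n → ℤ) → Prop}
    (hr : ∀ x y, r x y → r y x) {K : Finset (Fin n → ℤ)} (hK : Linked r K) {d : ℕ}
    (hd : d < affRank K) :
    ∃ L ⊆ K, Linked r L ∧ affRank L ≤ d ∧
      ∃ u ∈ L, ∃ v ∈ K, r u v ∧ d < affRank (insert v L) := by
  classical
  let P := K.powerset.filter fun L => Linked r L ∧ affRank L ≤ d
  have hmemP : ∀ L, L ∈ P ↔ L ⊆ K ∧ Linked r L ∧ affRank L ≤ d := by simp [P]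
  obtain ⟨x, hx⟩ := hK.1
  have hP : P.Nonempty := ⟨{x}, (hmemP _).2
    ⟨Finset.singleton_subset_iff.2 hx, linked_singleton x, by simp [affRank_singleton]⟩⟩
  obtain ⟨L, hLP, hmax⟩ := P.exists_maximal hP
  obtain ⟨hLK, hL, hLd⟩ := (hmemP L).1 hLP
  have hss : L ⊂ K := ⟨hLK, fun h => (affRank_mono h).not_gt (hLd.trans_lt hd)⟩
  obtain ⟨u, hu, v, hv, huv⟩ := hK.2 L hss hL.1
  obtain ⟨hvK, hvL⟩ := Finset.mem_sdiff.1 hv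
  refine ⟨L, hLK, hL, hLd, u, hu, v, hvK, huv, ?_⟩
  by_contra! hle
  exact hvL (hmax ((hmemP _).2 ⟨Finset.insert_subset hvK hLK, linked_insert hr hL hu huv, hle⟩)
    (Finset.subset_insert v L) (Finset.mem_insert_self v L))

end AffineRank

section Sphere

variable {n : ℕ}

-- The equation `‖v‖² = 2⟨v,a⟩` describes the sphere through the origin with centre `a`.
lemma norm_le_of_mem_span_of_norm_sq_eq {E : Type*} [NormedAddCommGroup E] [InnerProductSpace ℝ E]
    {T : Set E} {a a₀ : E} (ha : ∀ v ∈ T, ‖v‖ ^ 2 = 2 * inner ℝ a v)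
    (ha₀ : ∀ v ∈ T, ‖v‖ ^ 2 = 2 * inner ℝ a₀ v) {y : E} (hy : y ∈ Submodule.span ℝ T)
    (hya : ‖y‖ ^ 2 = 2 * inner ℝ a y) : ‖y‖ ≤ 2 * ‖a₀‖ := by
  have heq : inner ℝ a y = inner ℝ a₀ y :=
    LinearMap.eqOn_span (f := innerₛₗ ℝ a) (g := innerₛₗ ℝ a₀)
      (fun v hv => by
        change inner ℝ a v = inner ℝ a₀ v
        linarith [ha v hv, ha₀ v hv]) hy
  have hcs := real_inner_le_norm a₀ y
  rw [heq] at hya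
  by_contra! hlt
  nlinarith [norm_nonneg y, norm_nonneg a₀]

lemma exists_norm_le_of_mem_span (n : ℕ) (E : ℝ) : ∃ B : ℝ, ∀ T ⊆ latticeBall n E, ∀ a : Euc n,
    (∀ v ∈ T, ‖toEuc v‖ ^ 2 = 2 * inner ℝ a (toEuc v)) →
    ∀ y ∈ Submodule.span ℝ (toEuc '' (T : Set (Fin n → ℤ))),
      ‖y‖ ^ 2 = 2 * inner ℝ a y → ‖y‖ ≤ B := by
  have hfixed : ∀ T : Finset (Fin n → ℤ), ∃ B : ℝ, ∀ a : Euc n,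
      (∀ v ∈ T, ‖toEuc v‖ ^ 2 = 2 * inner ℝ a (toEuc v)) →
      ∀ y ∈ Submodule.span ℝ (toEuc '' (T : Set (Fin n → ℤ))),
        ‖y‖ ^ 2 = 2 * inner ℝ a y → ‖y‖ ≤ B := fun T => by
    by_cases h : ∃ a₀ : Euc n, ∀ v ∈ T, ‖toEuc v‖ ^ 2 = 2 * inner ℝ a₀ (toEuc v)
    · obtain ⟨a₀, h₀⟩ := h
      exact ⟨2 * ‖a₀‖, fun a ha y hy => norm_le_of_mem_span_of_norm_sq_eq
        (Set.forall_mem_image.2 ha) (Set.forall_mem_image.2 h₀) hy⟩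
    · exact ⟨0, fun a ha => absurd ⟨a, ha⟩ h⟩
  choose B hB using hfixed
  obtain ⟨B₀, hB₀⟩ := ((latticeBall n E).powerset.image B).exists_le
  exact ⟨B₀, fun T hT a ha y hy hya => (hB T a ha y hy hya).trans
    (hB₀ _ (Finset.mem_image_of_mem B (Finset.mem_powerset.2 hT)))⟩

theorem exists_dist_le_of_affRank_eq (n : ℕ) (E : ℝ) : ∃ B : ℝ,
    ∀ (ρ : ℝ) (K S : Finset (Fin n → ℤ)), K ⊆ S → (∀ k ∈ S, ‖toEuc k‖ = ρ) →
      (∀ x ∈ K, ∀ y ∈ K, dist (toEuc x) (toEuc y) ≤ E) → affRank K = affRank S →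
      ∀ x ∈ K, ∀ y ∈ S, dist (toEuc y) (toEuc x) ≤ B := by
  obtain ⟨B, hB⟩ := exists_norm_le_of_mem_span n E
  refine ⟨B, fun ρ K S hKS hρ hE hrank x hx y hy => ?_⟩
  have hsphere : ∀ z ∈ S, ‖toEuc (z - x)‖ ^ 2 = 2 * inner ℝ (-toEuc x) (toEuc (z - x)) := by
    intro z hz
    rw [map_sub, norm_sub_sq_real, inner_neg_left, inner_sub_right, real_inner_self_eq_norm_sq,
      hρ z hz, hρ x (hKS hx), real_inner_comm]
    ring
  rw [dist_toEuc]
  refine hB (K.image (· - x)) ?_ (-toEuc x) ?_ (toEuc (y - x)) ?_ (hsphere y hy)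
  · refine Finset.image_subset_iff.2 fun z hz => mem_latticeBall.2 ?_
    rw [← dist_toEuc]
    exact hE z hz x hx
  · exact Finset.forall_mem_image.2 fun z hz => hsphere z (hKS hz)
  · rw [← dirSpan_eq_span hx, Submodule.eq_of_le_of_finrank_eq (dirSpan_mono hKS) hrank, map_sub]
    exact sub_mem_dirSpan hy (hKS hx)

/-- Two frequencies are `M`-near if they are at distance at most `M`. -/
def Near (M : ℝ) (k l : Fin n → ℤ) : Prop := dist (toEuc k) (toEuc l) ≤ M

lemma Near.symm {M : ℝ} (k l : Fin n → ℤ) (h : Near M k l) : Near M l k := by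
  rwa [Near, dist_comm]

-- A maximal linked subset of rank at most `d` becomes, with one more point, a subset of full rank
-- and bounded diameter, which pins down the sphere.
lemma exists_dist_le_of_linked_of_affRank_le (n : ℕ) (M : ℝ) (d : ℕ) : ∃ D : ℝ,
    ∀ (ρ : ℝ) (K : Finset (Fin n → ℤ)), Linked (Near M) K → (∀ k ∈ K, ‖toEuc k‖ = ρ) →
      affRank K ≤ d → ∀ x ∈ K, ∀ y ∈ K, dist (toEuc x) (toEuc y) ≤ D := by
  induction d with
  | zero =>
    exact ⟨0, fun ρ K _ _ hd x hx y hy =>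
      (dist_eq_zero.2 (eq_of_affRank_eq_zero (Nat.le_zero.1 hd) hx hy)).le⟩
  | succ d ih =>
    obtain ⟨D, hD⟩ := ih
    obtain ⟨B, hB⟩ := exists_dist_le_of_affRank_eq n (D + M)
    refine ⟨max D (B + B), fun ρ K hK hρ hd x hx y hy => ?_⟩
    rcases Nat.lt_or_ge d (affRank K) with hlt | hle
    · obtain ⟨L, hLK, hL, hLd, u, hu, v, hv, huv, hins⟩ :=
        hK.exists_lt_affRank_insert Near.symm hlt
      have hvLK : insert v L ⊆ K := Finset.insert_subset hv hLK
      have hrank : affRank (insert v L) = affRank K := by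
        have := affRank_mono hvLK
        omega
      have hdiamL := hD ρ L hL (fun k hk => hρ k (hLK hk)) hLd
      have hM : 0 ≤ M := dist_nonneg.trans huv
      have hD0 : 0 ≤ D := dist_nonneg.trans (hdiamL u hu u hu)
      have hvdist : ∀ a ∈ L, dist (toEuc a) (toEuc v) ≤ D + M := fun a ha =>
        (dist_triangle _ (toEuc u) _).trans (add_le_add (hdiamL a ha u hu) huv)
      have hdiam : ∀ a ∈ insert v L, ∀ b ∈ insert v L,
          dist (toEuc a) (toEuc b) ≤ D + M := by
        simp only [Finset.forall_mem_insert, dist_self]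
        exact ⟨⟨by positivity, fun b hb => by rw [dist_comm]; exact hvdist b hb⟩,
          fun a ha => ⟨hvdist a ha, fun b hb => (hdiamL a ha b hb).trans (by linarith)⟩⟩
      have hball := hB ρ (insert v L) K hvLK hρ hdiam hrank v (Finset.mem_insert_self v L)
      calc dist (toEuc x) (toEuc y) ≤ dist (toEuc x) (toEuc v) + dist (toEuc y) (toEuc v) :=
            dist_triangle_right _ _ _
        _ ≤ B + B := add_le_add (hball x hx) (hball y hy)
        _ ≤ max D (B + B) := le_max_right _ _
    · exact (hD ρ K hK hρ hle x hx y hy).trans (le_max_left _ _)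

theorem exists_dist_le_of_linked (n : ℕ) (M : ℝ) : ∃ D : ℝ,
    ∀ (ρ : ℝ) (K : Finset (Fin n → ℤ)), Linked (Near M) K → (∀ k ∈ K, ‖toEuc k‖ = ρ) →
      ∀ x ∈ K, ∀ y ∈ K, dist (toEuc x) (toEuc y) ≤ D := by
  obtain ⟨D, hD⟩ := exists_dist_le_of_linked_of_affRank_le n M n
  exact ⟨D, fun ρ K hK hρ => hD ρ K hK hρ (affRank_le K)⟩

end Sphere

section Observability

section CompactSpace

variable {X : Type*} [TopologicalSpace X] [CompactSpace X] [MeasurableSpace X]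
  {μ : Measure X} [IsFiniteMeasure μ]

lemma integral_norm_sq_le (f : C(X, ℂ)) : ∫ x, ‖f x‖ ^ 2 ∂μ ≤ ‖f‖ ^ 2 * μ.real Set.univ :=
  (Real.le_norm_self _).trans <| norm_integral_le_of_norm_le_const <|
    Eventually.of_forall fun x => by
      rw [norm_pow, norm_norm]
      exact pow_le_pow_left₀ (norm_nonneg _) (f.norm_coe_le_norm x) 2

variable [OpensMeasurableSpace X] [μ.IsOpenPosMeasure] {χ : C(X, ℝ)}

lemma integral_mul_norm_sq_pos (hχ : ∀ x, 0 ≤ χ x)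
    {f : C(X, ℂ)} (hf : ∃ x, χ x ≠ 0 ∧ f x ≠ 0) : 0 < ∫ x, χ x * ‖f x‖ ^ 2 ∂μ := by
  obtain ⟨x, hχx, hfx⟩ := hf
  have hcont : Continuous fun x => χ x * ‖f x‖ ^ 2 := by fun_prop
  exact hcont.integral_pos_of_hasCompactSupport_nonneg_nonzero
    (HasCompactSupport.of_compactSpace _) (fun y => mul_nonneg (hχ y) (sq_nonneg _))
    (x := x) (by positivity)

lemma exists_mul_norm_sq_le_integral (hχ : ∀ x, 0 ≤ χ x)
    (W : Submodule ℂ C(X, ℂ)) [FiniteDimensional ℂ W]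
    (hW : ∀ f ∈ W, (∀ x, χ x ≠ 0 → f x = 0) → f = 0) :
    ∃ C : ℝ, 0 < C ∧ ∀ f ∈ W, C * ‖f‖ ^ 2 ≤ ∫ x, χ x * ‖f x‖ ^ 2 ∂μ := by
  let J : W → ℝ := fun f => ∫ x, χ x * ‖(f : C(X, ℂ)) x‖ ^ 2 ∂μ
  have : ProperSpace W := FiniteDimensional.proper ℂ W
  have hJ : Continuous J := by
    have h := continuous_parametric_integral_of_continuous (μ := μ)
      (f := fun (f : W) x => χ x * ‖(f : C(X, ℂ)) x‖ ^ 2) (by fun_prop) isCompact_univ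
    simpa only [Measure.restrict_univ] using h
  have hJ_pos : ∀ f ∈ Metric.sphere (0 : W) 1, 0 < J f := fun f hf => by
    refine integral_mul_norm_sq_pos hχ ?_
    by_contra! hzero
    simp [show f = 0 from Subtype.ext (hW f f.2 hzero)] at hf
  obtain ⟨C, hC, hmin⟩ := (isCompact_sphere (0 : W) 1).exists_forall_le' hJ.continuousOn hJ_pos
  suffices ∀ f : W, C * ‖f‖ ^ 2 ≤ J f from ⟨C, hC, fun f hf => this ⟨f, hf⟩⟩
  intro f
  rcases eq_or_ne f 0 with rfl | hf
  · simp [J]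
  have _ : 0 < ‖f‖ := norm_pos_iff.2 hf
  have hunit := hmin ((‖f‖⁻¹ : ℂ) • f) (mem_sphere_zero_iff_norm.2 (norm_smul_inv_norm hf))
  have hscale : J ((‖f‖⁻¹ : ℂ) • f) = (‖f‖ ^ 2)⁻¹ * J f := by
    simp only [J, ← integral_const_mul]
    congr 1 with x
    rw [Submodule.coe_smul, ContinuousMap.smul_apply, norm_smul, norm_inv, Complex.norm_real,
      norm_norm, mul_pow, inv_pow]
    ring
  rwa [hscale, ← div_eq_inv_mul, le_div_iff₀ (by positivity)] at hunit

lemma exists_mul_integral_norm_sq_le (hχ : ∀ x, 0 ≤ χ x)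
    (W : Submodule ℂ C(X, ℂ)) [FiniteDimensional ℂ W]
    (hW : ∀ f ∈ W, (∀ x, χ x ≠ 0 → f x = 0) → f = 0) :
    ∃ C : ℝ, 0 < C ∧ ∀ f ∈ W, C * ∫ x, ‖f x‖ ^ 2 ∂μ ≤ ∫ x, χ x * ‖f x‖ ^ 2 ∂μ := by
  obtain ⟨C, hC, hobs⟩ := exists_mul_norm_sq_le_integral (μ := μ) hχ W hW
  refine ⟨C / (μ.real Set.univ + 1), by positivity, fun f hf => ?_⟩
  calc C / (μ.real Set.univ + 1) * ∫ x, ‖f x‖ ^ 2 ∂μ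
      ≤ C / (μ.real Set.univ + 1) * (‖f‖ ^ 2 * (μ.real Set.univ + 1)) := by
        gcongr; exact (integral_norm_sq_le f).trans (by gcongr; linarith)
    _ = C * ‖f‖ ^ 2 := by field_simp
    _ ≤ ∫ x, χ x * ‖f x‖ ^ 2 ∂μ := hobs f hf

end CompactSpace

variable {n : ℕ}

lemma analyticOnNhd_lift_trigPoly (S : Finset (Fin n → ℤ)) (c : (Fin n → ℤ) → ℂ) :
    AnalyticOnNhd ℝ (lift (trigPoly S c)) Set.univ := by
  have h : lift (trigPoly S c) = fun x => ∑ k ∈ S, c k *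
      Complex.exp ((Complex.I • Complex.ofRealCLM.comp (innerSL ℝ (toEuc k))) x) := by
    funext x
    simp [lift, trigPoly_apply, mode_proj]
  rw [h]
  intro x _
  refine Finset.analyticAt_fun_sum _ fun k _ => analyticAt_const.mul ?_
  have hexp : AnalyticAt ℝ Complex.exp
      ((Complex.I • Complex.ofRealCLM.comp (innerSL ℝ (toEuc k))) x) :=
    analyticAt_cexp.restrictScalars
  exact hexp.comp (ContinuousLinearMap.analyticAt _ x)

theorem trigPoly_eq_zero_of_isOpen {S : Finset (Fin n → ℤ)} {c : (Fin n → ℤ) → ℂ}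
    {U : Set (Torus n)} (hU : IsOpen U) (hne : U.Nonempty) (h : ∀ x ∈ U, trigPoly S c x = 0) :
    trigPoly S c = 0 := by
  obtain ⟨x₀, hx₀⟩ := hne
  have hnhds : proj ⁻¹' U ∈ 𝓝 (rep x₀) :=
    (hU.preimage continuous_proj).mem_nhds (by simpa using hx₀)
  have hev : lift (trigPoly S c) =ᶠ[𝓝 (rep x₀)] 0 := by
    filter_upwards [hnhds] with y hy using h _ hy
  ext x
  have hx := (analyticOnNhd_lift_trigPoly S c).eqOn_zero_of_preconnected_of_eventuallyEq_zero
    isPreconnected_univ (Set.mem_univ _) hev (Set.mem_univ (rep x))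
  simpa [lift] using hx

variable {χ : C(Torus n, ℝ)}

lemma exists_observability_of_dist_le (h0 : ∀ x, 0 ≤ χ x) (hχ : ∃ x, χ x ≠ 0) (B : ℝ) :
    ∃ C : ℝ, 0 < C ∧ ∀ (S : Finset (Fin n → ℤ)) (x : Fin n → ℤ),
      (∀ y ∈ S, dist (toEuc y) (toEuc x) ≤ B) → ∀ c : (Fin n → ℤ) → ℂ,
        C * ∫ t, ‖trigPoly S c t‖ ^ 2 ≤ ∫ t, χ t * ‖trigPoly S c t‖ ^ 2 := by
  let W : Submodule ℂ C(Torus n, ℂ) := Submodule.span ℂ (mode '' (latticeBall n B : Set _))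
  have : FiniteDimensional ℂ W :=
    FiniteDimensional.span_of_finite ℂ ((latticeBall n B).finite_toSet.image mode)
  have hW : ∀ f ∈ W, (∀ t, χ t ≠ 0 → f t = 0) → f = 0 := fun f hf h => by
    obtain ⟨b, rfl⟩ := (Submodule.mem_span_image_finset_iff_exists_fun' ℂ).1 hf
    exact trigPoly_eq_zero_of_isOpen (U := {t | χ t ≠ 0})
      (isOpen_ne_fun χ.continuous continuous_const) hχ h
  obtain ⟨C, hC, hobs⟩ := exists_mul_integral_norm_sq_le (μ := volume) h0 W hW
  refine ⟨C, hC, fun S x hS c => ?_⟩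
  -- multiplication by a mode translates the frequencies
  have hmem : mode (-x) * trigPoly S c ∈ W := by
    rw [trigPoly, Finset.mul_sum]
    refine Submodule.sum_mem _ fun y hy => ?_
    have hshift : mode (-x) * c y • mode y = c y • mode (y - x) := by
      ext t
      simp only [ContinuousMap.mul_apply, ContinuousMap.smul_apply, mode_sub, mode_neg, smul_eq_mul]
      ring
    rw [hshift]
    refine W.smul_mem _ (Submodule.subset_span (Set.mem_image_of_mem _ ?_))
    rw [Finset.mem_coe, mem_latticeBall, ← dist_toEuc]
    exact hS y hy
  simpa using hobs _ hmem

lemma norm_integral_ofReal_sub_le {p : C(Torus n, ℂ)} {ε : ℝ} (hp : ∀ x, ‖(χ x : ℂ) - p x‖ ≤ ε)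
    (S : Finset (Fin n → ℤ)) (c : (Fin n → ℤ) → ℂ) :
    ‖((∫ x, χ x * ‖trigPoly S c x‖ ^ 2 : ℝ) : ℂ) - ∫ x, p x * (‖trigPoly S c x‖ : ℂ) ^ 2‖ ≤
      ε * ∫ x, ‖trigPoly S c x‖ ^ 2 := by
  rw [← integral_complex_ofReal, ← integral_sub (integrable_of_continuous (by fun_prop))
    (integrable_of_continuous (by fun_prop)), ← integral_const_mul]
  refine norm_integral_le_of_norm_le (integrable_of_continuous (by fun_prop))
    (Eventually.of_forall fun x => ?_)
  push_cast
  rw [← sub_mul, norm_mul, norm_pow, Complex.norm_real, norm_norm]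
  exact mul_le_mul_of_nonneg_right (hp x) (sq_nonneg _)

lemma sum_integral_norm_sq_cluster (S : Finset (Fin n → ℤ)) (κ : (Fin n → ℤ) → Fin n → ℤ)
    (c : (Fin n → ℤ) → ℂ) :
    ∑ q ∈ S.image κ, ∫ x, ‖trigPoly (cluster S κ q) c x‖ ^ 2 = ∫ x, ‖trigPoly S c x‖ ^ 2 := by
  simp only [integral_norm_sq_trigPoly, ← Finset.mul_sum, sum_cluster]

-- A trigonometric polynomial of degree `M` does not see the interaction of clusters at distance
-- more than `M`, and `χ` is uniformly close to one.
theorem exists_abs_integral_sub_sum_cluster_le (χ : C(Torus n, ℝ)) {ε : ℝ} (hε : 0 < ε) :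
    ∃ M : ℝ, ∀ (S : Finset (Fin n → ℤ)) (κ : (Fin n → ℤ) → Fin n → ℤ),
      (∀ k ∈ S, ∀ l ∈ S, Near M k l → κ k = κ l) → ∀ c : (Fin n → ℤ) → ℂ,
        |(∫ x, χ x * ‖trigPoly S c x‖ ^ 2) -
            ∑ q ∈ S.image κ, ∫ x, χ x * ‖trigPoly (cluster S κ q) c x‖ ^ 2| ≤
          ε * ∫ x, ‖trigPoly S c x‖ ^ 2 := by
  obtain ⟨F, b, hp⟩ := exists_trigPoly_near ⟨fun x => (χ x : ℂ), by fun_prop⟩ (half_pos hε)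
  obtain ⟨M, hM⟩ := (F.image fun m => ‖toEuc m‖).exists_le
  refine ⟨M, fun S κ hκ c => ?_⟩
  let I : Finset (Fin n → ℤ) → ℂ := fun T => ∫ x, trigPoly F b x * (‖trigPoly T c x‖ : ℂ) ^ 2
  have hadd : I S = ∑ q ∈ S.image κ, I (cluster S κ q) := by
    simp only [I, integral_mul_norm_sq_trigPoly (trigPoly F b).continuous]
    refine sum_sum_eq_sum_cluster fun k hk l hl hne => ?_
    have hF : k - l ∉ F := fun h => hne (hκ k hk l hl (by
      rw [Near, dist_toEuc]; exact hM _ (Finset.mem_image_of_mem _ h)))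
    rw [coeff_trigPoly, if_neg hF, mul_zero]
  have hS := norm_integral_ofReal_sub_le hp S c
  have hclusters := norm_sum_le_of_le (S.image κ) fun q _ =>
    norm_integral_ofReal_sub_le hp (cluster S κ q) c
  rw [← Finset.mul_sum, sum_integral_norm_sq_cluster, Finset.sum_sub_distrib] at hclusters
  rw [← Real.norm_eq_abs, ← Complex.norm_real, ← add_halves ε, add_mul]
  push_cast
  refine le_trans (le_of_eq ?_) ((norm_sub_le _ _).trans (add_le_add hS hclusters))
  congr 1
  linear_combination hadd

lemma exists_observability_of_affRank_lt (h0 : ∀ x, 0 ≤ χ x) (hχ : ∃ x, χ x ≠ 0) (d : ℕ) :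
    ∃ C : ℝ, 0 < C ∧ ∀ (ρ : ℝ) (S : Finset (Fin n → ℤ)), (∀ k ∈ S, ‖toEuc k‖ = ρ) →
      affRank S < d → ∀ c : (Fin n → ℤ) → ℂ,
        C * ∫ x, ‖trigPoly S c x‖ ^ 2 ≤ ∫ x, χ x * ‖trigPoly S c x‖ ^ 2 := by
  induction d with
  | zero => exact ⟨1, one_pos, fun ρ S _ h => absurd h (Nat.not_lt_zero _)⟩
  | succ d ih =>
    obtain ⟨C, hC, hobs⟩ := ih
    obtain ⟨M, hM⟩ := exists_abs_integral_sub_sum_cluster_le χ (half_pos hC)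
    obtain ⟨D, hD⟩ := exists_dist_le_of_linked n M
    obtain ⟨B, hB⟩ := exists_dist_le_of_affRank_eq n D
    obtain ⟨C', hC', hball⟩ := exists_observability_of_dist_le h0 hχ B
    refine ⟨min (C / 2) C', by positivity, fun ρ S hρ hd c => ?_⟩
    have hmass : 0 ≤ ∫ x, ‖trigPoly S c x‖ ^ 2 := integral_nonneg fun x => sq_nonneg _
    obtain ⟨κ, hκ⟩ := exists_isClustering (r := Near M) Near.symm S
    by_cases hfull : ∃ k ∈ S, affRank (cluster S κ (κ k)) = affRank S
    · obtain ⟨k, hk, hrank⟩ := hfull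
      have hsub := cluster_subset S κ (κ k)
      have hdiam := hD ρ _ (hκ.linked k hk) fun l hl => hρ l (hsub hl)
      have hfar := hB ρ _ S hsub hρ hdiam hrank k (mem_cluster.2 ⟨hk, rfl⟩)
      exact (mul_le_mul_of_nonneg_right (min_le_right _ _) hmass).trans (hball S k hfar c)
    · have hcluster : ∀ q ∈ S.image κ, C * ∫ x, ‖trigPoly (cluster S κ q) c x‖ ^ 2 ≤
          ∫ x, χ x * ‖trigPoly (cluster S κ q) c x‖ ^ 2 := fun q hq => by
        obtain ⟨k, hk, rfl⟩ := Finset.mem_image.1 hq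
        have hsub := cluster_subset S κ (κ k)
        have hlt := (affRank_mono hsub).lt_of_ne fun h => hfull ⟨k, hk, h⟩
        exact hobs ρ _ (fun l hl => hρ l (hsub hl)) (by omega) c
      have hsum := Finset.sum_le_sum hcluster
      rw [← Finset.mul_sum, sum_integral_norm_sq_cluster] at hsum
      have hsplit := (abs_le.1 (hM S κ hκ.eq_of_rel c)).1
      have hmin := mul_le_mul_of_nonneg_right (min_le_left (C / 2) C') hmass
      linarith

/-- `C` is a constant in the observability inequality, with weight `χ`, for the trigonometric
polynomials with frequencies on a common sphere, whatever its radius. -/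
def IsObservabilityConstant (χ : C(Torus n, ℝ)) (C : ℝ) : Prop :=
  ∀ (ρ : ℝ) (S : Finset (Fin n → ℤ)), (∀ k ∈ S, ‖toEuc k‖ = ρ) → ∀ c : (Fin n → ℤ) → ℂ,
    C * ∫ x, ‖trigPoly S c x‖ ^ 2 ≤ ∫ x, χ x * ‖trigPoly S c x‖ ^ 2

theorem exists_isObservabilityConstant (h0 : ∀ x, 0 ≤ χ x) (hχ : ∃ x, χ x ≠ 0) :
    ∃ C : ℝ, 0 < C ∧ IsObservabilityConstant χ C := by
  obtain ⟨C, hC, hobs⟩ := exists_observability_of_affRank_lt h0 hχ (n + 1)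
  exact ⟨C, hC, fun ρ S hρ => hobs ρ S hρ (Nat.lt_succ_of_le (affRank_le S))⟩

lemma exists_continuous_le_indicator {X : Type*} [TopologicalSpace X] [NormalSpace X] [T1Space X]
    {U : Set X} (hU : IsOpen U) (hne : U.Nonempty) :
    ∃ χ : C(X, ℝ), (∀ x, 0 ≤ χ x) ∧ (∀ x, χ x ≤ U.indicator 1 x) ∧ ∃ x, χ x ≠ 0 := by
  obtain ⟨x₀, hx₀⟩ := hne
  obtain ⟨χ, hzero, hone, hmem⟩ := exists_continuous_zero_one_of_isClosed hU.isClosed_compl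
    (isClosed_singleton (x := x₀)) (by simpa using hx₀)
  refine ⟨χ, fun x => (hmem x).1, fun x => ?_, x₀, by simp [hone rfl]⟩
  by_cases hx : x ∈ U
  · simpa [hx] using (hmem x).2
  · simpa [hx] using (hzero hx).le

end Observability

section Fourier

variable {n : ℕ}

lemma continuous_of_continuous_lift {f : Torus n → ℂ} (hf : Continuous (lift f)) : Continuous f :=
  isQuotientMap_proj.continuous_iff.2 hf

-- By invariance of the measure, the translates of `g` have the same integral.
lemma integral_eq_zero_of_hasDerivAt {g g' : Torus n → ℂ} {v : Euc n} (hg : Continuous g)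
    (hg' : Continuous g')
    (h : ∀ x, HasDerivAt (fun t : ℝ => g (x + proj (t • v))) (g' x) 0) : ∫ x, g' x = 0 := by
  obtain ⟨C, hC⟩ := isCompact_univ.exists_bound_of_continuousOn hg'.continuousOn
  have hderiv : ∀ (x : Torus n) (t : ℝ),
      HasDerivAt (fun s : ℝ => g (x + proj (s • v))) (g' (x + proj (t • v))) t := fun x t => by
    have hshift := HasDerivAt.comp_sub_const t t (by simpa using h (x + proj (t • v)))
    simpa [add_assoc, ← proj_add, ← add_smul] using hshift
  have hintegral := (hasDerivAt_integral_of_dominated_loc_of_deriv_le (μ := volume)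
    (F := fun (t : ℝ) x => g (x + proj (t • v))) (F' := fun (t : ℝ) x => g' (x + proj (t • v)))
    (x₀ := 0) (s := Set.univ) (bound := fun _ => C) univ_mem
    (Eventually.of_forall fun t => Continuous.aestronglyMeasurable (by fun_prop))
    (integrable_of_continuous (by fun_prop))
    (Continuous.aestronglyMeasurable (by fun_prop))
    (Eventually.of_forall fun x t _ => hC _ trivial)
    (integrable_of_continuous continuous_const)
    (Eventually.of_forall fun x t _ => hderiv x t)).2
  simp only [integral_add_right_eq_self] at hintegral
  exact hintegral.unique (hasDerivAt_const _ _)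

/-- The directional derivative of a function on the torus. -/
def torusDeriv (v : Euc n) (f : Torus n → ℂ) : Torus n → ℂ :=
  fun x => fderiv ℝ (lift f) (rep x) v

lemma lift_torusDeriv (v : Euc n) (f : Torus n → ℂ) :
    lift (torusDeriv v f) = fun x => fderiv ℝ (lift f) x v := by
  funext x
  have hperiod : (fun y => lift f (y + (rep (proj x) - x))) = lift f := by
    funext y
    simp [lift, proj_add, proj_sub]
  have hderiv := fderiv_comp_add_right (𝕜 := ℝ) (f := lift f) (x := x) (rep (proj x) - x)
  rw [hperiod, add_sub_cancel] at hderiv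
  simp only [lift, torusDeriv] at hderiv ⊢
  rw [hderiv]

lemma contDiff_lift_torusDeriv (v : Euc n) {f : Torus n → ℂ} {p q : WithTop ℕ∞}
    (hf : ContDiff ℝ p (lift f)) (hq : q + 1 ≤ p) : ContDiff ℝ q (lift (torusDeriv v f)) := by
  rw [lift_torusDeriv]
  exact (hf.fderiv_right hq).clm_apply contDiff_const

lemma hasDerivAt_torusDeriv (v : Euc n) {f : Torus n → ℂ} (hf : ContDiff ℝ 1 (lift f))
    (x : Torus n) : HasDerivAt (fun t : ℝ => f (x + proj (t • v))) (torusDeriv v f x) 0 := by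
  have hline : HasDerivAt (fun t : ℝ => rep x + t • v) v 0 := by
    simpa using ((hasDerivAt_id (0 : ℝ)).smul_const v).const_add (rep x)
  have hfderiv : HasFDerivAt (lift f) (fderiv ℝ (lift f) (rep x)) (rep x + (0 : ℝ) • v) := by
    simpa using (hf.differentiable one_ne_zero (rep x)).hasFDerivAt
  simpa [lift, proj_add, Function.comp_def, torusDeriv] using hfderiv.comp_hasDerivAt 0 hline

lemma hasDerivAt_mode (m : Fin n → ℤ) (v : Euc n) (x : Torus n) :
    HasDerivAt (fun t : ℝ => mode m (x + proj (t • v)))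
      (Complex.I * ((inner ℝ (toEuc m) v : ℝ) : ℂ) * mode m x) 0 := by
  have hexp := ((Complex.ofRealCLM.hasDerivAt (x := (0 : ℝ))).mul_const
    (Complex.I * ((inner ℝ (toEuc m) v : ℝ) : ℂ))).cexp.const_mul (mode m x)
  refine (hexp.congr_deriv (by simp; ring)).congr_of_eventuallyEq (Eventually.of_forall fun t => ?_)
  simp only [mode_apply_add, mode_proj, inner_smul_right, Complex.ofRealCLM_apply]
  push_cast
  ring_nf

lemma coeff_torusDeriv (v : Euc n) {f : Torus n → ℂ} (hf : ContDiff ℝ 1 (lift f))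
    (m : Fin n → ℤ) :
    coeff (torusDeriv v f) m = Complex.I * ((inner ℝ (toEuc m) v : ℝ) : ℂ) * coeff f m := by
  have hcont := continuous_of_continuous_lift hf.continuous
  have hcont' := continuous_of_continuous_lift
    (contDiff_lift_torusDeriv v (q := 0) hf (by simp)).continuous
  have hprod : ∀ x, HasDerivAt (fun t : ℝ => mode (-m) (x + proj (t • v)) * f (x + proj (t • v)))
      (-(Complex.I * ((inner ℝ (toEuc m) v : ℝ) : ℂ)) * (mode (-m) x * f x) +
        mode (-m) x * torusDeriv v f x) 0 := fun x => by
    have hx : x + proj ((0 : ℝ) • v) = x := by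
      ext i
      simp [proj]
    refine ((hasDerivAt_mode (-m) v x).mul (hasDerivAt_torusDeriv v hf x)).congr_deriv ?_
    rw [hx, map_neg, inner_neg_left]
    push_cast
    ring
  have hparts := integral_eq_zero_of_hasDerivAt (g := fun x => mode (-m) x * f x)
    (by fun_prop) (by fun_prop) hprod
  rw [integral_add (integrable_of_continuous (by fun_prop))
    (integrable_of_continuous (by fun_prop)), integral_const_mul] at hparts
  simp only [coeff]
  linear_combination hparts

lemma eq_zero_of_coeff_eq_zero {g : Torus n → ℂ} (hg : Continuous g) (h : ∀ m, coeff g m = 0) :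
    g = 0 := by
  have horth : ∀ S c, ∫ x, trigPoly S c x * g x = 0 := fun S c => by
    simp only [trigPoly_apply, Finset.sum_mul]
    rw [integral_finsetSum _ fun k _ => integrable_of_continuous (by fun_prop)]
    refine Finset.sum_eq_zero fun k _ => ?_
    simpa [mul_assoc, integral_const_mul, coeff] using Or.inr (h (-k))
  have hle : ∀ ε : ℝ, 0 < ε → ∫ x, ‖g x‖ ^ 2 ≤ ε * ∫ x, ‖g x‖ := fun ε hε => by
    obtain ⟨S, c, hp⟩ := exists_trigPoly_near ⟨fun x => conj (g x), by fun_prop⟩ hε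
    have hsq : ((∫ x, ‖g x‖ ^ 2 : ℝ) : ℂ) = ∫ x, (conj (g x) - trigPoly S c x) * g x := by
      simp only [sub_mul]
      rw [integral_sub (integrable_of_continuous (by fun_prop))
        (integrable_of_continuous (by fun_prop)), horth, sub_zero, ← integral_complex_ofReal]
      simp only [Complex.conj_mul', Complex.ofReal_pow]
    calc ∫ x, ‖g x‖ ^ 2 ≤ ‖((∫ x, ‖g x‖ ^ 2 : ℝ) : ℂ)‖ := by
          rw [Complex.norm_real]; exact Real.le_norm_self _
      _ ≤ ∫ x, ε * ‖g x‖ := by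
          rw [hsq]
          refine norm_integral_le_of_norm_le (integrable_of_continuous (by fun_prop))
            (Eventually.of_forall fun x => ?_)
          rw [norm_mul]
          exact mul_le_mul_of_nonneg_right (hp x) (norm_nonneg _)
      _ = ε * ∫ x, ‖g x‖ := integral_const_mul _ _
  have hcont : Continuous fun x => ‖g x‖ ^ 2 := by fun_prop
  have hzero : ∫ x, ‖g x‖ ^ 2 = 0 := by
    refine le_antisymm ?_ (integral_nonneg fun x => sq_nonneg _)
    by_contra! hpos
    have _ : 0 ≤ ∫ x, ‖g x‖ := integral_nonneg fun x => norm_nonneg _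
    have hbound := hle ((∫ x, ‖g x‖ ^ 2) / ((∫ x, ‖g x‖) + 1)) (by positivity)
    rw [div_mul_eq_mul_div, le_div_iff₀ (by positivity)] at hbound
    linarith
  have hfun : (fun x => ‖g x‖ ^ 2) = fun _ => (0 : ℝ) :=
    (hcont.ae_eq_iff_eq volume continuous_const).1 ((integral_eq_zero_iff_of_nonneg
      (fun x => sq_nonneg _) (integrable_of_continuous hcont)).1 hzero)
  funext x
  simpa using congrFun hfun x

end Fourier

section Eigenfunctions

variable {n : ℕ}

lemma laplacian_lift {f : Torus n → ℂ} (hf : ContDiff ℝ 2 (lift f)) (x : Euc n) :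
    Laplacian.laplacian (lift f) x = ∑ i, lift (torusDeriv (EuclideanSpace.basisFun (Fin n) ℝ i)
      (torusDeriv (EuclideanSpace.basisFun (Fin n) ℝ i) f)) x := by
  rw [InnerProductSpace.laplacian_eq_iteratedFDeriv_orthonormalBasis _
    (EuclideanSpace.basisFun (Fin n) ℝ)]
  refine Finset.sum_congr rfl fun i _ => ?_
  simp only [lift_torusDeriv, iteratedFDeriv_two_apply]
  rw [fderiv_clm_apply
    ((hf.fderiv_right (m := 1) le_rfl).differentiable one_ne_zero x)
    (differentiableAt_const _)]
  simp

lemma coeff_torusDeriv_torusDeriv {f : Torus n → ℂ} (hf : ContDiff ℝ 2 (lift f)) (v : Euc n)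
    (m : Fin n → ℤ) :
    coeff (torusDeriv v (torusDeriv v f)) m = -((inner ℝ (toEuc m) v ^ 2 : ℝ) : ℂ) * coeff f m := by
  rw [coeff_torusDeriv _ (contDiff_lift_torusDeriv _ hf le_rfl),
    coeff_torusDeriv _ (hf.of_le one_le_two)]
  push_cast
  linear_combination (inner ℝ (toEuc m) v : ℂ) ^ 2 * coeff f m * Complex.I_mul_I

variable {lam : ℝ} {ψ : Torus n → ℂ}

namespace IsNormalizedEigenfunction

lemma continuous (hψ : IsNormalizedEigenfunction lam ψ) : Continuous ψ :=
  continuous_of_continuous_lift hψ.smooth.continuous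

lemma norm_sq_mul_coeff (hψ : IsNormalizedEigenfunction lam ψ) (m : Fin n → ℤ) :
    ((‖toEuc m‖ ^ 2 : ℝ) : ℂ) * coeff ψ m = (lam : ℂ) ^ 2 * coeff ψ m := by
  have hsmooth : ContDiff ℝ 2 (lift ψ) := hψ.smooth.of_le (by norm_cast)
  let e := EuclideanSpace.basisFun (Fin n) ℝ
  have hcont : ∀ i, Continuous (torusDeriv (e i) (torusDeriv (e i) ψ)) := fun i =>
    continuous_of_continuous_lift (contDiff_lift_torusDeriv _ (q := 0)
      (contDiff_lift_torusDeriv _ (q := 1) hsmooth le_rfl) (by simp)).continuous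
  have heigen : ∀ x, (lam : ℂ) ^ 2 * ψ x = -∑ i, torusDeriv (e i) (torusDeriv (e i) ψ) x :=
    fun x => by
      have h := hψ.eigen (rep x)
      rw [laplacian_lift hsmooth] at h
      simpa [lift, e] using h.symm
  symm
  calc (lam : ℂ) ^ 2 * coeff ψ m
      = ∫ x, -∑ i, mode (-m) x * torusDeriv (e i) (torusDeriv (e i) ψ) x := by
        rw [coeff, ← integral_const_mul]
        simp only [mul_left_comm ((lam : ℂ) ^ 2), heigen, Finset.mul_sum, mul_neg]
    _ = -∑ i, coeff (torusDeriv (e i) (torusDeriv (e i) ψ)) m := by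
        rw [integral_neg, integral_finsetSum _ fun i _ => integrable_of_continuous (by fun_prop)]
        rfl
    _ = ((‖toEuc m‖ ^ 2 : ℝ) : ℂ) * coeff ψ m := by
        simp only [coeff_torusDeriv_torusDeriv hsmooth, ← Finset.sum_mul, Finset.sum_neg_distrib,
          neg_mul, neg_neg, ← Complex.ofReal_sum]
        simp only [e, ← (EuclideanSpace.basisFun (Fin n) ℝ).sum_sq_inner_left (toEuc m)]

lemma coeff_eq_zero (hψ : IsNormalizedEigenfunction lam ψ) {m : Fin n → ℤ}
    (hm : ‖toEuc m‖ ≠ |lam|) : coeff ψ m = 0 := by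
  by_contra hne
  have hsq : ‖toEuc m‖ ^ 2 = lam ^ 2 := by
    exact_mod_cast mul_right_cancel₀ hne (hψ.norm_sq_mul_coeff m)
  exact hm (by rwa [sq_eq_sq_iff_abs_eq_abs, abs_norm] at hsq)

theorem exists_eq_trigPoly (hψ : IsNormalizedEigenfunction lam ψ) :
    ∃ (S : Finset (Fin n → ℤ)) (c : (Fin n → ℤ) → ℂ),
      (∀ k ∈ S, ‖toEuc k‖ = |lam|) ∧ ψ = trigPoly S c := by
  let S := (latticeBall n |lam|).filter fun k => ‖toEuc k‖ = |lam|
  let c : (Fin n → ℤ) → ℂ := fun k => ((2 * Real.pi) ^ n : ℂ)⁻¹ * coeff ψ k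
  have hmem : ∀ k, k ∈ S ↔ ‖toEuc k‖ = |lam| := fun k => by
    simpa [S] using fun h : ‖toEuc k‖ = |lam| => h.le
  have hcont := hψ.continuous
  refine ⟨S, c, fun k hk => (hmem k).1 hk, sub_eq_zero.1 <|
    eq_zero_of_coeff_eq_zero (hcont.sub (trigPoly S c).continuous) fun m => ?_⟩
  have hsub : coeff (ψ - ⇑(trigPoly S c)) m = coeff ψ m - coeff (trigPoly S c) m := by
    simp only [coeff, Pi.sub_apply, mul_sub]
    exact integral_sub (integrable_of_continuous (by fun_prop))
      (integrable_of_continuous (by fun_prop))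
  rw [hsub, coeff_trigPoly]
  split_ifs with hm
  · have : (Real.pi : ℂ) ≠ 0 := by exact_mod_cast Real.pi_ne_zero
    simp only [c]
    field_simp
    ring
  · rw [hψ.coeff_eq_zero (mt (hmem m).2 hm), sub_zero]

end IsNormalizedEigenfunction

lemma IsObservabilityConstant.le_integral_mul_norm_sq {χ : C(Torus n, ℝ)} {C : ℝ}
    (hC : IsObservabilityConstant χ C) (hψ : IsNormalizedEigenfunction lam ψ) :
    C ≤ ∫ x, χ x * ‖ψ x‖ ^ 2 := by
  obtain ⟨S, c, hS, rfl⟩ := hψ.exists_eq_trigPoly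
  simpa [hψ.normalized] using hC |lam| S hS c

lemma integral_mul_norm_sq_le_setIntegral {U : Set (Torus n)} (hU : IsOpen U) {χ : C(Torus n, ℝ)}
    (hχ : ∀ x, χ x ≤ U.indicator 1 x) (hψ : Continuous ψ) :
    ∫ x, χ x * ‖ψ x‖ ^ 2 ≤ ∫ x in U, ‖ψ x‖ ^ 2 := by
  rw [← integral_indicator hU.measurableSet]
  refine integral_mono (integrable_of_continuous (by fun_prop))
    ((integrable_of_continuous (by fun_prop)).indicator hU.measurableSet) fun x => ?_
  calc χ x * ‖ψ x‖ ^ 2 ≤ U.indicator 1 x * ‖ψ x‖ ^ 2 :=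
        mul_le_mul_of_nonneg_right (hχ x) (sq_nonneg _)
    _ = U.indicator (fun x => ‖ψ x‖ ^ 2) x := by by_cases hx : x ∈ U <;> simp [hx]

end Eigenfunctions

section PlaneWave

variable {n : ℕ}

/-- The plane wave `ξ ↦ exp(i⟨w, ξ⟩)` of frequency `w`, a character of `ℝⁿ`. -/
def planeWave (w ξ : Euc n) : ℂ := Complex.exp (Complex.I * ((inner ℝ w ξ : ℝ) : ℂ))

@[fun_prop]
lemma Continuous.planeWave {X : Type*} [TopologicalSpace X] {f g : X → Euc n}
    (hf : Continuous f) (hg : Continuous g) :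
    Continuous fun x => FlatTorus.planeWave (f x) (g x) := by
  unfold FlatTorus.planeWave
  fun_prop

@[simp] lemma norm_planeWave (w ξ : Euc n) : ‖planeWave w ξ‖ = 1 := by
  rw [planeWave, mul_comm, Complex.norm_exp_ofReal_mul_I]

lemma hasFDerivAt_planeWave (w ξ : Euc n) :
    HasFDerivAt (planeWave w)
      (planeWave w ξ • (Complex.I • Complex.ofRealCLM.comp (innerSL ℝ w))) ξ :=
  ((Complex.I • Complex.ofRealCLM.comp (innerSL ℝ w)).hasFDerivAt (x := ξ)).cexp

end PlaneWave

section Symbols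

variable {n : ℕ} {a : Cotangent n → ℂ}

lemma continuous_symbol (ha : a ∈ TestFunctions n) : Continuous a :=
  ((isOpenMap_proj.prodMap IsOpenMap.id).isQuotientMap (continuous_proj.prodMap continuous_id)
    (proj_surjective.prodMap Function.surjective_id)).continuous_iff.2 ha.1.continuous

lemma exists_isCompact_momentum (ha : a ∈ TestFunctions n) :
    ∃ K : Set (Euc n), IsCompact K ∧ ∀ x, ∀ ξ ∉ K, a (x, ξ) = 0 :=
  ⟨Prod.snd '' tsupport a, ha.2.image continuous_snd, fun x ξ hξ =>
    image_eq_zero_of_notMem_tsupport fun h => hξ ⟨(x, ξ), h, rfl⟩⟩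

lemma exists_norm_symbol_le (ha : a ∈ TestFunctions n) : ∃ C, ∀ z, ‖a z‖ ≤ C :=
  ha.2.exists_bound_of_continuous (continuous_symbol ha)

lemma continuous_fibre (ha : a ∈ TestFunctions n) (x : Torus n) : Continuous fun ξ => a (x, ξ) :=
  (continuous_symbol ha).comp (by fun_prop)

lemma hasCompactSupport_fibre (ha : a ∈ TestFunctions n) (x : Torus n) :
    HasCompactSupport fun ξ => a (x, ξ) :=
  let ⟨_, hK, hzero⟩ := exists_isCompact_momentum ha
  HasCompactSupport.intro hK (hzero x)

/-- The derivative of a symbol in the direction `v` of `ℝⁿ × ℝⁿ`. -/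
def symDeriv (v : Euc n × Euc n) (a : Cotangent n → ℂ) : Cotangent n → ℂ :=
  fun z => fderiv ℝ (liftSymbol a) (rep z.1, z.2) v

lemma liftSymbol_symDeriv (v : Euc n × Euc n) (a : Cotangent n → ℂ) :
    liftSymbol (symDeriv v a) = fun p => fderiv ℝ (liftSymbol a) p v := by
  funext p
  have hperiod : (fun y => liftSymbol a (y + (rep (proj p.1) - p.1, 0))) = liftSymbol a := by
    funext y
    simp [liftSymbol, proj_add, proj_sub]
  have hderiv := fderiv_comp_add_right (𝕜 := ℝ) (f := liftSymbol a) (x := p)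
    (rep (proj p.1) - p.1, 0)
  have hshift : p + (rep (proj p.1) - p.1, 0) = (rep (proj p.1), p.2) := by
    ext1 <;> simp
  rw [hperiod, hshift] at hderiv
  rw [hderiv]
  rfl

lemma symDeriv_eq_zero (v : Euc n × Euc n) {z : Cotangent n} (hz : z ∉ tsupport a) :
    symDeriv v a z = 0 := by
  have hlift : Tendsto (fun p : Euc n × Euc n => (proj p.1, p.2)) (𝓝 (rep z.1, z.2)) (𝓝 z) := by
    convert (by fun_prop : Continuous fun p : Euc n × Euc n => (proj p.1, p.2)).tendsto _ using 2
    simp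
  have hlocal : liftSymbol a =ᶠ[𝓝 (rep z.1, z.2)] fun _ => 0 :=
    hlift.eventually (notMem_tsupport_iff_eventuallyEq.1 hz)
  simp [symDeriv, hlocal.fderiv_eq]

lemma symDeriv_mem (v : Euc n × Euc n) (ha : a ∈ TestFunctions n) :
    symDeriv v a ∈ TestFunctions n := by
  refine ⟨?_, HasCompactSupport.intro ha.2 fun _ => symDeriv_eq_zero v⟩
  rw [liftSymbol_symDeriv]
  exact (ha.1.fderiv_right (m := ∞) (by simp)).clm_apply contDiff_const

lemma contDiff_lift_symbol (ha : a ∈ TestFunctions n) (ξ : Euc n) :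
    ContDiff ℝ ∞ (lift fun x => a (x, ξ)) :=
  ha.1.comp (contDiff_id.prodMk contDiff_const)

lemma torusDeriv_symbol (ha : a ∈ TestFunctions n) (v ξ : Euc n) :
    torusDeriv v (fun x => a (x, ξ)) = fun x => symDeriv (v, 0) a (x, ξ) := by
  funext x
  have hsymbol := HasFDerivAt.comp (f := fun y : Euc n => (y, ξ)) (rep x)
    (ha.1.differentiable (by simp) (rep x, ξ)).hasFDerivAt (hasFDerivAt_prodMk_left (rep x) ξ)
  exact congrArg (· v) hsymbol.fderiv

lemma hasFDerivAt_fibre (ha : a ∈ TestFunctions n) (x : Torus n) (ξ : Euc n) :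
    HasFDerivAt (fun η => a (x, η)) ((fderiv ℝ (liftSymbol a) (rep x, ξ)).comp
      (ContinuousLinearMap.inr ℝ (Euc n) (Euc n))) ξ := by
  have hsymbol := (ha.1.differentiable (by simp) (rep x, ξ)).hasFDerivAt.comp ξ
    (hasFDerivAt_prodMk_right (rep x) ξ)
  simpa [Function.comp_def, liftSymbol] using hsymbol

end Symbols

section MomentumFourier

variable {n : ℕ} {a : Cotangent n → ℂ}

/-- The Fourier transform of a symbol in the momentum variable. -/
def momentumFourier (a : Cotangent n → ℂ) (x : Torus n) (w : Euc n) : ℂ :=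
  ∫ ξ, a (x, ξ) * planeWave w ξ

lemma momentumFourier_eq_setIntegral {K : Set (Euc n)} (hK : ∀ x, ∀ ξ ∉ K, a (x, ξ) = 0)
    (x : Torus n) (w : Euc n) :
    momentumFourier a x w = ∫ ξ in K, a (x, ξ) * planeWave w ξ :=
  (setIntegral_eq_integral_of_forall_compl_eq_zero fun ξ hξ => by rw [hK x ξ hξ, zero_mul]).symm

lemma continuous_momentumFourier (ha : a ∈ TestFunctions n) :
    Continuous fun z : Torus n × Euc n => momentumFourier a z.1 z.2 := by
  obtain ⟨K, hK, hzero⟩ := exists_isCompact_momentum ha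
  have := continuous_symbol ha
  simp only [momentumFourier_eq_setIntegral hzero]
  refine continuous_parametric_integral_of_continuous ?_ hK
  change Continuous fun p : (Torus n × Euc n) × Euc n => a (p.1.1, p.2) * planeWave p.1.2 p.2
  fun_prop

lemma exists_norm_momentumFourier_le (ha : a ∈ TestFunctions n) :
    ∃ C, ∀ x w, ‖momentumFourier a x w‖ ≤ C := by
  obtain ⟨K, hK, hzero⟩ := exists_isCompact_momentum ha
  obtain ⟨C, hC⟩ := exists_norm_symbol_le ha
  refine ⟨C * (volume : Measure (Euc n)).real K, fun x w => ?_⟩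
  rw [momentumFourier_eq_setIntegral hzero]
  exact norm_setIntegral_le_of_norm_le_const hK.measure_lt_top fun ξ _ => by simpa using hC _

lemma momentumFourier_symDeriv (ha : a ∈ TestFunctions n) (v : Euc n) (x : Torus n) (w : Euc n) :
    momentumFourier (symDeriv (0, v) a) x w =
      -(Complex.I * ((inner ℝ w v : ℝ) : ℂ)) * momentumFourier a x w := by
  have hwave : ∀ ξ, fderiv ℝ (planeWave w) ξ v =
      Complex.I * ((inner ℝ w v : ℝ) : ℂ) * planeWave w ξ := fun ξ => by
    rw [(hasFDerivAt_planeWave w ξ).fderiv]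
    simp [mul_comm]
  have hfibre : ∀ ξ, fderiv ℝ (fun η => a (x, η)) ξ v = symDeriv (0, v) a (x, ξ) := fun ξ => by
    rw [(hasFDerivAt_fibre ha x ξ).fderiv]
    simp [symDeriv]
  have hcont : Continuous (planeWave w) := by fun_prop
  have hint : ∀ {b}, b ∈ TestFunctions n → Integrable fun ξ => planeWave w ξ * b (x, ξ) :=
    fun hb => (hcont.mul (continuous_fibre hb x)).integrable_of_hasCompactSupport
      (hasCompactSupport_fibre hb x).mul_left
  have hparts := integral_mul_fderiv_eq_neg_fderiv_mul_of_integrable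
    (μ := (volume : Measure (Euc n))) (f := planeWave w) (g := fun ξ => a (x, ξ)) (v := v)
    (by simpa only [hwave, mul_assoc] using ((hint ha).const_mul _).const_mul _)
    (by simpa only [hfibre] using hint (symDeriv_mem (0, v) ha)) (hint ha)
    (fun ξ _ => (hasFDerivAt_planeWave w ξ).differentiableAt)
    (fun ξ _ => (hasFDerivAt_fibre ha x ξ).differentiableAt)
  simp only [hwave, hfibre, mul_assoc, integral_const_mul] at hparts
  simp only [momentumFourier, mul_comm _ (planeWave w _), hparts]
  ring

end MomentumFourier

section SymCoeff

variable {n : ℕ} {a : Cotangent n → ℂ}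

/-- The Fourier coefficient of a symbol in the position variable. -/
def symCoeff (a : Cotangent n → ℂ) (m : Fin n → ℤ) (ξ : Euc n) : ℂ := coeff (fun x => a (x, ξ)) m

lemma continuous_symCoeff (ha : a ∈ TestFunctions n) (m : Fin n → ℤ) :
    Continuous (symCoeff a m) := by
  have := continuous_symbol ha
  have hcont := continuous_parametric_integral_of_continuous (μ := (volume : Measure (Torus n)))
    (f := fun (ξ : Euc n) x => mode (-m) x * a (x, ξ))
    (by
      change Continuous fun p : Euc n × Torus n => mode (-m) p.2 * a (p.2, p.1)
      fun_prop) isCompact_univ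
  simp only [setIntegral_univ] at hcont
  exact hcont

lemma hasCompactSupport_symCoeff (ha : a ∈ TestFunctions n) (m : Fin n → ℤ) :
    HasCompactSupport (symCoeff a m) := by
  obtain ⟨K, hK, hzero⟩ := exists_isCompact_momentum ha
  exact HasCompactSupport.intro hK fun ξ hξ => by simp [symCoeff, coeff, hzero _ ξ hξ]

lemma exists_norm_symCoeff_le (ha : a ∈ TestFunctions n) : ∃ C, ∀ m ξ, ‖symCoeff a m ξ‖ ≤ C :=
  let ⟨_, hC⟩ := exists_norm_symbol_le ha
  ⟨_, fun m ξ => norm_coeff_le (fun x => hC (x, ξ)) m⟩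

lemma symCoeff_symDeriv (ha : a ∈ TestFunctions n) (v : Euc n) (m : Fin n → ℤ) (ξ : Euc n) :
    symCoeff (symDeriv (v, 0) a) m ξ =
      Complex.I * ((inner ℝ (toEuc m) v : ℝ) : ℂ) * symCoeff a m ξ := by
  rw [symCoeff, ← torusDeriv_symbol ha,
    coeff_torusDeriv v ((contDiff_lift_symbol ha ξ).of_le (mod_cast le_top)), symCoeff]

end SymCoeff

section Decay

variable {n : ℕ} {a : Cotangent n → ℂ}

lemma norm_le_sum_abs (w : Euc n) : ‖w‖ ≤ ∑ i, |w i| := by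
  conv_lhs => rw [← (EuclideanSpace.basisFun (Fin n) ℝ).sum_repr w]
  exact (norm_sum_le _ _).trans_eq (by simp [norm_smul])

-- Repeated integration by parts, stated once for both `momentumFourier` and `symCoeff`.
lemma exists_pow_mul_norm_le {ι : Type*} {T : (Cotangent n → ℂ) → ι → ℂ} {w : ι → Euc n}
    {J : Euc n → Euc n × Euc n} (hT : ∀ a ∈ TestFunctions n, ∃ C, ∀ z, ‖T a z‖ ≤ C)
    (hJ : ∀ a ∈ TestFunctions n, ∀ v z,
      ‖T (symDeriv (J v) a) z‖ = |inner ℝ (w z) v| * ‖T a z‖)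
    (N : ℕ) (ha : a ∈ TestFunctions n) : ∃ C, ∀ z, (1 + ‖w z‖) ^ N * ‖T a z‖ ≤ C := by
  induction N generalizing a with
  | zero => simpa using hT a ha
  | succ N ih =>
    obtain ⟨C₀, hC₀⟩ := ih ha
    choose C hC using fun i => ih (symDeriv_mem (J (EuclideanSpace.single i 1)) ha)
    refine ⟨C₀ + ∑ i, C i, fun z => ?_⟩
    calc (1 + ‖w z‖) ^ (N + 1) * ‖T a z‖
        ≤ (1 + ∑ i, |w z i|) * ((1 + ‖w z‖) ^ N * ‖T a z‖) := by
          rw [pow_succ', mul_assoc]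
          gcongr
          exact norm_le_sum_abs _
      _ = (1 + ‖w z‖) ^ N * ‖T a z‖ + ∑ i, (1 + ‖w z‖) ^ N * (|w z i| * ‖T a z‖) := by
          rw [add_mul, one_mul, Finset.sum_mul]
          simp only [mul_left_comm |w z _|]
      _ ≤ C₀ + ∑ i, C i := by
          gcongr with i
          · exact hC₀ z
          · simpa [hJ a ha, EuclideanSpace.inner_single_right] using hC i z

lemma exists_pow_mul_norm_momentumFourier_le (ha : a ∈ TestFunctions n) (N : ℕ) :
    ∃ C, ∀ x w, (1 + ‖w‖) ^ N * ‖momentumFourier a x w‖ ≤ C := by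
  obtain ⟨C, hC⟩ := exists_pow_mul_norm_le (T := fun a z => momentumFourier a z.1 z.2)
    (w := fun z : Torus n × Euc n => z.2) (J := fun v => (0, v))
    (fun a ha => let ⟨C, hC⟩ := exists_norm_momentumFourier_le ha; ⟨C, fun z => hC z.1 z.2⟩)
    (fun a ha v z => by simp [momentumFourier_symDeriv ha]) N ha
  exact ⟨C, fun x w => hC (x, w)⟩

lemma exists_pow_mul_norm_symCoeff_le (ha : a ∈ TestFunctions n) (N : ℕ) :
    ∃ C, ∀ m ξ, (1 + ‖toEuc m‖) ^ N * ‖symCoeff a m ξ‖ ≤ C := by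
  obtain ⟨C, hC⟩ := exists_pow_mul_norm_le (T := fun a z => symCoeff a z.1 z.2)
    (w := fun z : (Fin n → ℤ) × Euc n => toEuc z.1) (J := fun v => (v, 0))
    (fun a ha => let ⟨C, hC⟩ := exists_norm_symCoeff_le ha; ⟨C, fun z => hC z.1 z.2⟩)
    (fun a ha v z => by simp [symCoeff_symDeriv ha]) N ha
  exact ⟨C, fun m ξ => hC (m, ξ)⟩

lemma toEuc_injective : Function.Injective (toEuc (n := n)) := fun k l h => by
  funext i
  exact_mod_cast (congrArg (· i) h : (k i : ℝ) = l i)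

lemma summable_inv_one_add_norm_toEuc_pow (n : ℕ) :
    Summable fun m : Fin n → ℤ => ((1 + ‖toEuc m‖) ^ (n + 1))⁻¹ := by
  classical
  set b := (EuclideanSpace.basisFun (Fin n) ℝ).toBasis
  have hmem : ∀ m : Fin n → ℤ, toEuc m ∈ Submodule.span ℤ (Set.range b) := fun m =>
    (b.mem_span_iff_repr_mem ℤ _).2 fun i => ⟨m i, by simp [b]⟩
  have hrank : Module.finrank ℤ (Submodule.span ℤ (Set.range b)) < n + 1 := by
    rw [ZLattice.rank ℝ]
    simp
  have hsum := (ZLattice.summable_norm_pow_inv _ (n + 1) hrank).comp_injective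
    (i := fun m : Fin n → ℤ => ⟨toEuc m, hmem m⟩)
    fun k l h => toEuc_injective (congrArg Subtype.val h)
  refine Summable.of_norm_bounded_eventually hsum ?_
  filter_upwards [(Set.finite_singleton (0 : Fin n → ℤ)).compl_mem_cofinite] with m hm
  have hpos : 0 < ‖toEuc m‖ := norm_pos_iff.2 fun h => hm (toEuc_injective (h.trans (by simp)))
  rw [Real.norm_of_nonneg (by positivity)]
  simp only [Function.comp_apply, Submodule.coe_norm, inv_pow]
  gcongr
  linarith

lemma exists_summable_norm_symCoeff_le (ha : a ∈ TestFunctions n) :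
    ∃ s : (Fin n → ℤ) → ℝ, Summable s ∧ ∀ m ξ, ‖symCoeff a m ξ‖ ≤ s m := by
  obtain ⟨C, hC⟩ := exists_pow_mul_norm_symCoeff_le ha (n + 1)
  refine ⟨_, (summable_inv_one_add_norm_toEuc_pow n).mul_left C, fun m ξ => ?_⟩
  rw [← div_eq_mul_inv, le_div_iff₀ (by positivity), mul_comm]
  exact hC m ξ

end Decay

section FourierInversion

variable {n : ℕ}

open scoped FourierTransform

lemma fourierInv_eq_integral_planeWave (f : Euc n → ℂ) (v : Euc n) :
    𝓕⁻ f v = ∫ ξ, f ξ * planeWave ((2 * Real.pi) • v) ξ := by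
  rw [Real.fourierInv_eq']
  congr 1 with ξ
  rw [smul_eq_mul, mul_comm, planeWave, inner_smul_left, real_inner_comm]
  congr 2
  simp
  ring

lemma integral_comp_two_pi_smul (g : Euc n → ℂ) :
    (2 * Real.pi) ^ n * ∫ v, g ((2 * Real.pi) • v) = ∫ w, g w := by
  have hpi : (2 * Real.pi : ℂ) ≠ 0 := by exact_mod_cast Real.two_pi_pos.ne'
  rw [Measure.integral_comp_smul, finrank_euclideanSpace_fin, abs_of_pos (by positivity),
    Complex.real_smul, ← mul_assoc]
  push_cast
  rw [mul_inv_cancel₀ (pow_ne_zero n hpi), one_mul]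

lemma integral_planeWave_neg_mul_integral {f : Euc n → ℂ} (hf : Continuous f)
    (hint : Integrable f) (htransform : Integrable fun w => ∫ ξ, f ξ * planeWave w ξ) (η : Euc n) :
    ∫ w, planeWave w (-η) * ∫ ξ, f ξ * planeWave w ξ = (2 * Real.pi) ^ n * f η := by
  have hfourier : Integrable (𝓕 f) := by
    have heq : 𝓕 f = fun v => ∫ ξ, f ξ * planeWave ((-(2 * Real.pi)) • v) ξ := by
      funext v
      rw [neg_smul, ← smul_neg, ← fourierInv_eq_integral_planeWave,
        Real.fourierInv_eq_fourier_neg, neg_neg]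
    rw [heq]
    exact htransform.comp_smul (neg_ne_zero.2 Real.two_pi_pos.ne')
  rw [← congrFun (hf.fourier_fourierInv_eq hint hfourier) η, Real.fourier_eq',
    ← integral_comp_two_pi_smul]
  congr 2 with v
  rw [smul_eq_mul, fourierInv_eq_integral_planeWave, planeWave, inner_smul_left, inner_neg_right]
  congr 2
  simp
  ring

end FourierInversion

section Weyl

variable {n : ℕ} {h : ℝ} {a : Cotangent n → ℂ}

/-- The integrand of `⟨u, Op_h(a)v⟩` after the change of variables `y = x - hw`, as a function
of `(x, w)`. -/
def wignerIntegrand (h : ℝ) (a : Cotangent n → ℂ) (u v : Torus n → ℂ) (z : Torus n × Euc n) : ℂ :=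
  conj (u z.1) * (momentumFourier a (z.1 - proj ((h / 2) • z.2)) z.2 * v (z.1 - proj (h • z.2)))

lemma weylOp_eq_integral_momentumFourier (hh : 0 < h) (a : Cotangent n → ℂ) (u : Torus n → ℂ)
    (x : Euc n) :
    weylOp h a (lift u) x = ((2 * Real.pi : ℂ) ^ n)⁻¹ *
      ∫ w, momentumFourier a (proj x - proj ((h / 2) • w)) w * u (proj x - proj (h • w)) := by
  set G : Euc n → ℂ := fun y =>
    momentumFourier a (proj ((1 / 2 : ℝ) • (x + y))) (h⁻¹ • (x - y)) * lift u y with hG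
  have hweyl : weylOp h a (lift u) x = (((2 * Real.pi * h) ^ n)⁻¹ : ℝ) * ∫ y, G y := by
    simp only [weylOp, hG, momentumFourier, planeWave, inner_smul_left, div_eq_inv_mul,
      conj_trivial]
  have hchange : ∫ w, G (x - h • w) = ((h ^ n)⁻¹ : ℝ) * ∫ y, G y := by
    rw [Measure.integral_comp_smul volume (fun y => G (x - y)) h, integral_sub_left_eq_self,
      finrank_euclideanSpace_fin, abs_of_pos (by positivity), Complex.real_smul]
  have hG' : ∀ w, G (x - h • w) =
      momentumFourier a (proj x - proj ((h / 2) • w)) w * u (proj x - proj (h • w)) := fun w => by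
    have hmid : (1 / 2 : ℝ) • (x + (x - h • w)) = x - (h / 2) • w := by module
    have hdiff : h⁻¹ • (x - (x - h • w)) = w := by
      rw [sub_sub_cancel, smul_smul, inv_mul_cancel₀ hh.ne', one_smul]
    simp only [hG, hmid, hdiff, lift, proj_sub]
  simp only [← hG', hchange, hweyl, mul_pow, mul_inv]
  push_cast
  ring

lemma integrable_of_pow_mul_norm_le {Θ : Torus n × Euc n → ℂ} (hΘ : Continuous Θ) {C : ℝ}
    (hC : ∀ z, (1 + ‖z.2‖) ^ (n + 1) * ‖Θ z‖ ≤ C) : Integrable Θ := by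
  have hdecay : Integrable fun w : Euc n => (1 + ‖w‖) ^ (-((n : ℝ) + 1)) :=
    integrable_one_add_norm (by simp)
  refine ((integrable_const C).mul_prod hdecay).mono' hΘ.aestronglyMeasurable
    (Eventually.of_forall fun z => ?_)
  rw [Real.rpow_neg (by positivity), ← div_eq_mul_inv, le_div_iff₀ (by positivity), mul_comm]
  exact_mod_cast hC z

lemma integrable_wignerIntegrand (h : ℝ) (ha : a ∈ TestFunctions n) (u v : C(Torus n, ℂ)) :
    Integrable (wignerIntegrand h a u v) := by
  have hfourier : Continuous fun z : Torus n × Euc n =>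
      momentumFourier a (z.1 - proj ((h / 2) • z.2)) z.2 :=
    (continuous_momentumFourier ha).comp
      (f := fun z : Torus n × Euc n => (z.1 - proj ((h / 2) • z.2), z.2)) (by fun_prop)
  obtain ⟨C, hC⟩ := exists_pow_mul_norm_momentumFourier_le ha (n + 1)
  refine integrable_of_pow_mul_norm_le (C := ‖u‖ * (C * ‖v‖)) ?_ fun z => ?_
  · exact (Complex.continuous_conj.comp (by fun_prop)).mul (hfourier.mul (by fun_prop))
  · rw [wignerIntegrand, norm_mul, norm_mul, Complex.norm_conj, mul_left_comm,
      ← mul_assoc _ _ ‖v _‖]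
    gcongr
    · exact u.norm_coe_le_norm _
    · exact (mul_nonneg (by positivity) (norm_nonneg _)).trans (hC 0 0)
    · exact hC _ _
    · exact v.norm_coe_le_norm _

lemma wigner_eq_integral_wignerIntegrand (hh : 0 < h) (ha : a ∈ TestFunctions n)
    (u : C(Torus n, ℂ)) :
    wigner h u a = ((2 * Real.pi : ℂ) ^ n)⁻¹ * ∫ z, wignerIntegrand h a u u z := by
  have hint := integrable_wignerIntegrand h ha u u
  have hfibre : ∀ x : Euc n, conj (lift u x) * weylOp h a (lift u) x =
      (fun X => ((2 * Real.pi : ℂ) ^ n)⁻¹ * ∫ w, wignerIntegrand h a u u (X, w)) (proj x) := by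
    intro x
    simp only [weylOp_eq_integral_momentumFourier hh, wignerIntegrand, lift, integral_const_mul]
    ring
  simp only [wigner, hfibre]
  rw [setIntegral_box_proj (hint.integral_prod_left.aestronglyMeasurable.const_mul _),
    integral_const_mul]
  congr 1
  exact (integral_prod _ hint).symm

lemma integral_mode_mul_momentumFourier (ha : a ∈ TestFunctions n) (m : Fin n → ℤ) (w : Euc n) :
    ∫ x, mode (-m) x * momentumFourier a x w = ∫ ξ, symCoeff a m ξ * planeWave w ξ := by
  have := continuous_symbol ha
  have hint : Integrable (fun z : Torus n × Euc n => mode (-m) z.1 * (a z * planeWave w z.2))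
      (volume.prod volume) :=
    Continuous.integrable_of_hasCompactSupport (by fun_prop) ha.2.mul_right.mul_left
  simp only [momentumFourier, symCoeff, coeff, ← integral_const_mul, ← integral_mul_const]
  rw [integral_integral_swap hint]
  simp only [mul_assoc]

lemma integrable_integral_symCoeff_mul_planeWave (ha : a ∈ TestFunctions n) (m : Fin n → ℤ) :
    Integrable fun w => ∫ ξ, symCoeff a m ξ * planeWave w ξ := by
  simp only [← integral_mode_mul_momentumFourier ha]
  have := continuous_momentumFourier ha
  obtain ⟨C, hC⟩ := exists_pow_mul_norm_momentumFourier_le ha (n + 1)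
  have hint : Integrable (fun z : Torus n × Euc n => mode (-m) z.1 * momentumFourier a z.1 z.2) :=
    integrable_of_pow_mul_norm_le (by fun_prop) (C := C) fun z => by simpa using hC z.1 z.2
  exact hint.integral_prod_right

lemma wignerIntegrand_mode (h : ℝ) (a : Cotangent n → ℂ) (k l : Fin n → ℤ) (x : Torus n)
    (w : Euc n) :
    wignerIntegrand h a (mode k) (mode l) (x + proj ((h / 2) • w), w) =
      planeWave w (-((h / 2) • (toEuc k + toEuc l))) *
        (mode (-(k - l)) x * momentumFourier a x w) := by
  have hback : x + proj ((h / 2) • w) - proj (h • w) = x + proj (-((h / 2) • w)) := by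
    rw [add_sub_assoc, ← proj_sub]
    congr 2
    module
  have hphase : mode (-k) (proj ((h / 2) • w)) * mode l (proj (-((h / 2) • w))) =
      planeWave w (-((h / 2) • (toEuc k + toEuc l))) := by
    rw [mode_proj, mode_proj, planeWave, ← Complex.exp_add]
    congr 1
    rw [map_neg, inner_neg_left, inner_neg_right, inner_neg_right, inner_smul_right,
      inner_smul_right, inner_smul_right, inner_add_right, real_inner_comm w, real_inner_comm w]
    push_cast
    ring
  simp only [wignerIntegrand, hback, add_sub_cancel_right, mode_apply_add, ← hphase]
  rw [neg_sub, sub_eq_add_neg, mode_add, mode_neg, mode_neg, map_mul]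
  ring

lemma integral_wignerIntegrand_mode (h : ℝ) (ha : a ∈ TestFunctions n) (k l : Fin n → ℤ) :
    ∫ z, wignerIntegrand h a (mode k) (mode l) z =
      (2 * Real.pi) ^ n * symCoeff a (k - l) ((h / 2) • (toEuc k + toEuc l)) := by
  have hinner : ∀ w, ∫ x, wignerIntegrand h a (mode k) (mode l) (x, w) =
      planeWave w (-((h / 2) • (toEuc k + toEuc l))) *
        ∫ ξ, symCoeff a (k - l) ξ * planeWave w ξ := fun w => by
    rw [← integral_mode_mul_momentumFourier ha, ← integral_const_mul,
      ← integral_add_right_eq_self _ (proj ((h / 2) • w))]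
    simp only [wignerIntegrand_mode]
  have hcont := continuous_symCoeff ha (k - l)
  calc ∫ z, wignerIntegrand h a (mode k) (mode l) z
      = ∫ w, ∫ x, wignerIntegrand h a (mode k) (mode l) (x, w) :=
        integral_prod_symm _ (integrable_wignerIntegrand h ha (mode k) (mode l))
    _ = (2 * Real.pi) ^ n * symCoeff a (k - l) ((h / 2) • (toEuc k + toEuc l)) := by
        simp only [hinner]
        exact integral_planeWave_neg_mul_integral hcont
          (hcont.integrable_of_hasCompactSupport (hasCompactSupport_symCoeff ha _))
          (integrable_integral_symCoeff_mul_planeWave ha _) _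

theorem wigner_trigPoly (hh : 0 < h) (ha : a ∈ TestFunctions n) (S : Finset (Fin n → ℤ))
    (c : (Fin n → ℤ) → ℂ) :
    wigner h (trigPoly S c) a = ∑ k ∈ S, ∑ l ∈ S,
      conj (c k) * c l * symCoeff a (k - l) ((h / 2) • (toEuc k + toEuc l)) := by
  have hexpand : ∀ z, wignerIntegrand h a (trigPoly S c) (trigPoly S c) z = ∑ k ∈ S, ∑ l ∈ S,
      conj (c k) * c l * wignerIntegrand h a (mode k) (mode l) z := fun z => by
    simp only [wignerIntegrand, trigPoly_apply, map_sum, map_mul]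
    rw [Finset.mul_sum, Finset.sum_mul_sum]
    refine Finset.sum_congr rfl fun k _ => Finset.sum_congr rfl fun l _ => ?_
    ring
  have hint : ∀ k l, Integrable fun z =>
      conj (c k) * c l * wignerIntegrand h a (mode k) (mode l) z := fun k l =>
    (integrable_wignerIntegrand h ha (mode k) (mode l)).const_mul _
  have hpi : (2 * Real.pi : ℂ) ^ n ≠ 0 := pow_ne_zero n (by exact_mod_cast Real.two_pi_pos.ne')
  rw [wigner_eq_integral_wignerIntegrand hh ha]
  simp only [hexpand]
  rw [integral_finsetSum _ fun k _ => integrable_finsetSum _ fun l _ => hint k l, Finset.mul_sum]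
  refine Finset.sum_congr rfl fun k _ => ?_
  rw [integral_finsetSum _ fun l _ => hint k l, Finset.mul_sum]
  refine Finset.sum_congr rfl fun l _ => ?_
  rw [integral_const_mul, integral_wignerIntegrand_mode h ha, mul_left_comm _ (_ ^ n),
    inv_mul_cancel_left₀ hpi]

end Weyl

section Kernels

lemma sum_comp_le_tsum {ι κ : Type*} {b : κ → ℝ} (hb : Summable b) (h0 : ∀ m, 0 ≤ b m)
    (S : Finset ι) {f : ι → κ} (hf : Function.Injective f) : ∑ l ∈ S, b (f l) ≤ ∑' m, b m :=
  ((hb.comp_injective hf).sum_le_tsum S fun _ _ => h0 _).trans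
    (tsum_comp_le_tsum_of_inj hb h0 hf)

theorem norm_sum_sum_conj_mul_le {G : Type*} [AddGroup G] {b : G → ℝ} (hb : Summable b)
    (h0 : ∀ m, 0 ≤ b m) (S : Finset G) (c : G → ℂ) {K : G → G → ℂ}
    (hK : ∀ k ∈ S, ∀ l ∈ S, ‖K k l‖ ≤ b (k - l)) :
    ‖∑ k ∈ S, ∑ l ∈ S, conj (c k) * c l * K k l‖ ≤ (∑ k ∈ S, ‖c k‖ ^ 2) * ∑' m, b m := by
  have hterm : ∀ k ∈ S, ∀ l ∈ S, ‖conj (c k) * c l * K k l‖ ≤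
      ‖c k‖ ^ 2 / 2 * b (k - l) + ‖c l‖ ^ 2 / 2 * b (k - l) := fun k hk l hl => by
    rw [norm_mul, norm_mul, Complex.norm_conj, ← add_mul]
    refine mul_le_mul ?_ (hK k hk l hl) (norm_nonneg _) (by positivity)
    linarith [two_mul_le_add_sq ‖c k‖ ‖c l‖]
  have hrows : ∑ k ∈ S, ∑ l ∈ S, ‖c k‖ ^ 2 / 2 * b (k - l) ≤
      ∑ k ∈ S, ‖c k‖ ^ 2 / 2 * ∑' m, b m := by
    simp only [← Finset.mul_sum]
    gcongr with k
    exact sum_comp_le_tsum hb h0 S (sub_right_injective (b := k))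
  have hcols : ∑ k ∈ S, ∑ l ∈ S, ‖c l‖ ^ 2 / 2 * b (k - l) ≤
      ∑ l ∈ S, ‖c l‖ ^ 2 / 2 * ∑' m, b m := by
    rw [Finset.sum_comm]
    simp only [← Finset.mul_sum]
    gcongr with l
    exact sum_comp_le_tsum hb h0 S (sub_left_injective (b := l))
  calc ‖∑ k ∈ S, ∑ l ∈ S, conj (c k) * c l * K k l‖
      ≤ ∑ k ∈ S, ∑ l ∈ S, (‖c k‖ ^ 2 / 2 * b (k - l) + ‖c l‖ ^ 2 / 2 * b (k - l)) :=
        norm_sum_le_of_le _ fun k hk => norm_sum_le_of_le _ fun l hl => hterm k hk l hl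
    _ ≤ ∑ k ∈ S, ‖c k‖ ^ 2 / 2 * ∑' m, b m + ∑ l ∈ S, ‖c l‖ ^ 2 / 2 * ∑' m, b m := by
        simp only [Finset.sum_add_distrib]
        exact add_le_add hrows hcols
    _ = (∑ k ∈ S, ‖c k‖ ^ 2) * ∑' m, b m := by
        rw [← Finset.sum_mul, ← Finset.sum_div]
        ring

lemma exists_modulus_of_continuity {X E : Type*} [PseudoMetricSpace X] [SeminormedAddCommGroup E]
    {f : X → E} (hf : UniformContinuous f) {s : ℝ} (hs0 : 0 ≤ s) (hs : ∀ x, ‖f x‖ ≤ s) :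
    ∃ β : ℝ → ℝ, (∀ δ, 0 ≤ β δ) ∧ (∀ δ, β δ ≤ 2 * s) ∧ Tendsto β (𝓝 0) (𝓝 0) ∧
      ∀ δ x y, dist x y ≤ δ → ‖f x - f y‖ ≤ β δ := by
  have hbound : ∀ x y, ‖f x - f y‖ ≤ 2 * s := fun x y => by
    linarith [norm_sub_le (f x) (f y), hs x, hs y]
  let β : ℝ → ℝ := fun δ => ⨆ p : {p : X × X // dist p.1 p.2 ≤ δ}, ‖f p.1.1 - f p.1.2‖
  refine ⟨β, fun δ => Real.iSup_nonneg fun _ => norm_nonneg _,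
    fun δ => Real.iSup_le (fun _ => hbound _ _) (by positivity), ?_, fun δ x y hxy => ?_⟩
  · rw [Metric.tendsto_nhds]
    intro ε hε
    obtain ⟨η, hη, hu⟩ := Metric.uniformContinuous_iff.1 hf (ε / 2) (half_pos hε)
    filter_upwards [eventually_lt_nhds hη] with δ hδ
    have hle : β δ ≤ ε / 2 := Real.iSup_le (fun p => by
      rw [← dist_eq_norm]
      exact (hu (p.2.trans_lt hδ)).le) (half_pos hε).le
    rw [Real.dist_0_eq_abs, abs_of_nonneg (Real.iSup_nonneg fun _ => norm_nonneg _)]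
    exact hle.trans_lt (half_lt_self hε)
  · exact le_ciSup (f := fun p : {p : X × X // dist p.1 p.2 ≤ δ} => ‖f p.1.1 - f p.1.2‖)
      ⟨2 * s, by rintro _ ⟨p, rfl⟩; exact hbound _ _⟩ ⟨(x, y), hxy⟩

end Kernels

section ClusterComparison

variable {n : ℕ} {a : Cotangent n → ℂ} {h : ℝ}

theorem exists_summable_bounds_symCoeff (ha : a ∈ TestFunctions n) :
    ∃ b : ℕ → (Fin n → ℤ) → ℝ, (∀ N m, 0 ≤ b N m) ∧ (∀ N, Summable (b N)) ∧
      Tendsto (fun N => ∑' m, b N m) atTop (𝓝 0) ∧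
      (∀ (N : ℕ) m ξ η, dist ξ η ≤ 1 / ((N : ℝ) + 1) →
        ‖symCoeff a m ξ - symCoeff a m η‖ ≤ b N m) ∧
      ∀ (N : ℕ) m ξ, N < ‖toEuc m‖ → ‖symCoeff a m ξ‖ ≤ b N m := by
  obtain ⟨s, hs, has⟩ := exists_summable_norm_symCoeff_le ha
  have hs0 : ∀ m, 0 ≤ s m := fun m => (norm_nonneg _).trans (has m 0)
  choose β hβ0 hβs hβlim hβ using fun m => exists_modulus_of_continuity
    ((hasCompactSupport_symCoeff ha m).uniformContinuous_of_continuous (continuous_symCoeff ha m))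
    (hs0 m) (has m)
  have hdiff : ∀ m ξ η, ‖symCoeff a m ξ - symCoeff a m η‖ ≤ 2 * s m := fun m ξ η => by
    linarith [norm_sub_le (symCoeff a m ξ) (symCoeff a m η), has m ξ, has m η]
  let b : ℕ → (Fin n → ℤ) → ℝ := fun N m =>
    if ‖toEuc m‖ ≤ N then β m (1 / ((N : ℝ) + 1)) else 2 * s m
  have hb0 : ∀ N m, 0 ≤ b N m := fun N m => by
    simp only [b]
    split_ifs
    exacts [hβ0 _ _, mul_nonneg two_pos.le (hs0 m)]
  have hbs : ∀ N m, b N m ≤ 2 * s m := fun N m => by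
    simp only [b]
    split_ifs
    exacts [hβs _ _, le_rfl]
  have hblim : ∀ m, Tendsto (b · m) atTop (𝓝 0) := fun m =>
    ((hβlim m).comp tendsto_one_div_add_atTop_nhds_zero_nat).congr' <| by
      filter_upwards [tendsto_natCast_atTop_atTop.eventually_ge_atTop ‖toEuc m‖] with N hN
      exact (if_pos hN).symm
  refine ⟨b, hb0, fun N => .of_nonneg_of_le (hb0 N) (hbs N) (hs.mul_left 2), ?_, ?_, ?_⟩
  · simpa using tendsto_tsum_of_dominated_convergence (hs.mul_left 2) hblim <|
      .of_forall fun N m => (Real.norm_of_nonneg (hb0 N m)).trans_le (hbs N m)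
  · intro N m ξ η hξη
    simp only [b]
    split_ifs
    exacts [hβ m _ ξ η hξη, hdiff m ξ η]
  · intro N m ξ hm
    simp only [b, if_neg hm.not_ge]
    linarith [has m ξ, hs0 m]

lemma sum_integral_mul_norm_sq_cluster {g : (Fin n → ℤ) → Torus n → ℂ} (hg : ∀ q, Continuous (g q))
    (S : Finset (Fin n → ℤ)) (κ : (Fin n → ℤ) → Fin n → ℤ) (c : (Fin n → ℤ) → ℂ) :
    ∑ q ∈ S.image κ, ∫ x, g q x * (‖trigPoly (cluster S κ q) c x‖ : ℂ) ^ 2 =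
      ∑ k ∈ S, ∑ l ∈ S,
        conj (c k) * c l * if κ k = κ l then coeff (g (κ k)) (k - l) else 0 := by
  rw [sum_sum_eq_sum_cluster (κ := κ) fun k _ l _ hkl => by rw [if_neg hkl, mul_zero]]
  refine Finset.sum_congr rfl fun q _ => ?_
  rw [integral_mul_norm_sq_trigPoly (hg q)]
  refine Finset.sum_congr rfl fun k hk => Finset.sum_congr rfl fun l hl => ?_
  rw [(mem_cluster.1 hk).2, (mem_cluster.1 hl).2, if_pos rfl]

lemma dist_smul_add_le {E : Type*} [SeminormedAddCommGroup E] [NormedSpace ℝ E] (hh : 0 ≤ h)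
    {D : ℝ} {x y z : E} (hx : dist x z ≤ D) (hy : dist y z ≤ D) :
    dist ((h / 2) • (x + y)) (h • z) ≤ h * D := by
  have hsplit : (h / 2) • (x + y) - h • z = (h / 2) • ((x - z) + (y - z)) := by module
  rw [dist_eq_norm] at hx hy ⊢
  rw [hsplit, norm_smul, Real.norm_of_nonneg (by positivity)]
  calc h / 2 * ‖(x - z) + (y - z)‖ ≤ h / 2 * (D + D) := by
        gcongr
        exact norm_add_le_of_le hx hy
    _ = h * D := by ring

-- Inside a cluster the momentum `h (k + l) / 2` is almost constant; different clusters are so far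
-- apart that only small Fourier coefficients of the symbol couple them.
theorem norm_wigner_sub_sum_cluster_le (hh : 0 < h) (ha : a ∈ TestFunctions n)
    {b : (Fin n → ℤ) → ℝ} (hb0 : ∀ m, 0 ≤ b m) (hb : Summable b) {δ M D : ℝ}
    (hclose : ∀ m ξ η, dist ξ η ≤ δ → ‖symCoeff a m ξ - symCoeff a m η‖ ≤ b m)
    (hfar : ∀ m ξ, M < ‖toEuc m‖ → ‖symCoeff a m ξ‖ ≤ b m)
    {S : Finset (Fin n → ℤ)} {κ : (Fin n → ℤ) → Fin n → ℤ}
    (hκ : ∀ k ∈ S, ∀ l ∈ S, Near M k l → κ k = κ l)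
    (hD : ∀ k ∈ S, dist (toEuc k) (toEuc (κ k)) ≤ D) (hδ : h * D ≤ δ) (c : (Fin n → ℤ) → ℂ) :
    ‖wigner h (trigPoly S c) a - ∑ q ∈ S.image κ, ∫ x, a (x, h • toEuc q) *
      (‖trigPoly (cluster S κ q) c x‖ : ℂ) ^ 2‖ ≤ (∑ k ∈ S, ‖c k‖ ^ 2) * ∑' m, b m := by
  have := continuous_symbol ha
  rw [wigner_trigPoly hh ha,
    sum_integral_mul_norm_sq_cluster (g := fun q x => a (x, h • toEuc q)) fun q => by fun_prop]
  simp only [← Finset.sum_sub_distrib, ← mul_sub]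
  refine norm_sum_sum_conj_mul_le hb hb0 S c fun k hk l hl => ?_
  split_ifs with hkl
  · refine hclose _ _ _ ((dist_smul_add_le hh.le (hD k hk) ?_).trans hδ)
    rw [hkl]
    exact hD l hl
  · rw [sub_zero]
    refine hfar _ _ (lt_of_not_ge fun hM => hkl (hκ k hk l hl ?_))
    rwa [Near, dist_toEuc]

end ClusterComparison

section ClusterMeasure

variable {n : ℕ} {h : ℝ} {S : Finset (Fin n → ℤ)} {κ : (Fin n → ℤ) → Fin n → ℤ}
  {c : (Fin n → ℤ) → ℂ} {y : (Fin n → ℤ) → Metric.sphere (0 : Euc n) 1}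

/-- The unit cosphere bundle of the torus; unlike the cotangent bundle, it is compact. -/
abbrev Cosphere (n : ℕ) : Type := Torus n × Metric.sphere (0 : Euc n) 1

/-- The inclusion of the unit cosphere bundle in the cotangent bundle. -/
def cosphereIncl (z : Cosphere n) : Cotangent n := (z.1, z.2.1)

@[fun_prop]
lemma continuous_cosphereIncl : Continuous (cosphereIncl (n := n)) := by
  unfold cosphereIncl
  fun_prop

lemma integrable_of_continuous_cosphere {E : Type*} [NormedAddCommGroup E]
    {m : Measure (Cosphere n)} [IsFiniteMeasure m] {g : Cosphere n → E} (hg : Continuous g) :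
    Integrable g m :=
  hg.integrable_of_hasCompactSupport (.of_compactSpace _)

/-- The sum over the clusters of `S` of the position densities of the corresponding parts of the
trigonometric polynomial with coefficients `c`, each placed at the momentum which `y` assigns to
the label of the cluster. -/
def clusterMeasure (S : Finset (Fin n → ℤ)) (κ : (Fin n → ℤ) → Fin n → ℤ) (c : (Fin n → ℤ) → ℂ)
    (y : (Fin n → ℤ) → Metric.sphere (0 : Euc n) 1) : Measure (Cosphere n) :=
  ∑ q ∈ S.image κ, (volume.withDensity fun x =>
    ((‖trigPoly (cluster S κ q) c x‖₊ ^ 2 : NNReal) : ENNReal)).map fun x => (x, y q)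

lemma isFiniteMeasure_withDensity_nnnorm_sq (u : C(Torus n, ℂ)) :
    IsFiniteMeasure (volume.withDensity fun x => ((‖u x‖₊ ^ 2 : NNReal) : ENNReal)) := by
  refine isFiniteMeasure_withDensity (ne_of_lt ?_)
  have hint : Integrable (fun x => ‖u x‖ ^ 2) := integrable_of_continuous (by fun_prop)
  simpa [HasFiniteIntegral, enorm_eq_nnnorm] using hint.hasFiniteIntegral

instance : IsFiniteMeasure (clusterMeasure S κ c y) := by
  have := fun q => isFiniteMeasure_withDensity_nnnorm_sq (trigPoly (cluster S κ q) c)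
  unfold clusterMeasure
  infer_instance

lemma integral_clusterMeasure {E : Type*} [NormedAddCommGroup E] [NormedSpace ℝ E]
    {g : Cosphere n → E} (hg : Continuous g) :
    ∫ z, g z ∂clusterMeasure S κ c y =
      ∑ q ∈ S.image κ, ∫ x, ‖trigPoly (cluster S κ q) c x‖ ^ 2 • g (x, y q) := by
  have := fun q => isFiniteMeasure_withDensity_nnnorm_sq (trigPoly (cluster S κ q) c)
  rw [clusterMeasure, integral_finsetSum_measure fun q _ => integrable_of_continuous_cosphere hg]
  refine Finset.sum_congr rfl fun q _ => ?_
  rw [integral_map (by fun_prop) hg.aestronglyMeasurable,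
    integral_withDensity_eq_integral_smul (by fun_prop)]
  simp only [NNReal.smul_def, NNReal.coe_pow, coe_nnnorm]

lemma isProbabilityMeasure_clusterMeasure (hc : ∫ x, ‖trigPoly S c x‖ ^ 2 = 1) :
    IsProbabilityMeasure (clusterMeasure S κ c y) := by
  have hmass := integral_clusterMeasure (S := S) (κ := κ) (c := c) (y := y)
    (continuous_const (y := (1 : ℝ)))
  simp only [smul_eq_mul, mul_one, sum_integral_norm_sq_cluster, hc, integral_const] at hmass
  exact ⟨(ENNReal.toReal_eq_one_iff _).1 hmass⟩

lemma IsObservabilityConstant.le_integral_clusterMeasure {χ : C(Torus n, ℝ)} {C ρ : ℝ}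
    (hC : IsObservabilityConstant χ C) (hS : ∀ k ∈ S, ‖toEuc k‖ = ρ)
    (hc : ∫ x, ‖trigPoly S c x‖ ^ 2 = 1) : C ≤ ∫ z, χ z.1 ∂clusterMeasure S κ c y := by
  rw [integral_clusterMeasure (by fun_prop)]
  calc C = ∑ q ∈ S.image κ, C * ∫ x, ‖trigPoly (cluster S κ q) c x‖ ^ 2 := by
        rw [← Finset.mul_sum, sum_integral_norm_sq_cluster, hc, mul_one]
    _ ≤ ∑ q ∈ S.image κ, ∫ x, χ x * ‖trigPoly (cluster S κ q) c x‖ ^ 2 :=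
        Finset.sum_le_sum fun q _ => hC ρ _ (fun k hk => hS k (cluster_subset S κ q hk)) c
    _ = ∑ q ∈ S.image κ, ∫ x, ‖trigPoly (cluster S κ q) c x‖ ^ 2 • χ x := by
        simp only [smul_eq_mul, mul_comm]

lemma exists_sphere_eq_smul_toEuc (hh : 0 < h) (hS : ∀ k ∈ S, ‖toEuc k‖ = h⁻¹)
    (hne : S.Nonempty) :
    ∃ y : (Fin n → ℤ) → Metric.sphere (0 : Euc n) 1, ∀ k ∈ S, (y k : Euc n) = h • toEuc k := by
  have hmem : ∀ k ∈ S, h • toEuc k ∈ Metric.sphere (0 : Euc n) 1 := fun k hk => by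
    rw [mem_sphere_zero_iff_norm, norm_smul, hS k hk, Real.norm_of_nonneg hh.le,
      mul_inv_cancel₀ hh.ne']
  obtain ⟨k₀, hk₀⟩ := hne
  exact ⟨fun k => if hk : k ∈ S then ⟨_, hmem k hk⟩ else ⟨_, hmem k₀ hk₀⟩,
    fun k hk => by simp only [dif_pos hk]⟩

lemma IsNormalizedEigenfunction.exists_eq_trigPoly_of_inv {ψ : Torus n → ℂ} (hh : 0 < h)
    (hψ : IsNormalizedEigenfunction h⁻¹ ψ) :
    ∃ (S : Finset (Fin n → ℤ)) (c : (Fin n → ℤ) → ℂ)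
      (y : (Fin n → ℤ) → Metric.sphere (0 : Euc n) 1),
      (∀ k ∈ S, ‖toEuc k‖ = h⁻¹) ∧ ψ = trigPoly S c ∧ ∫ x, ‖trigPoly S c x‖ ^ 2 = 1 ∧
        ∀ k ∈ S, (y k : Euc n) = h • toEuc k := by
  obtain ⟨S, c, hS, rfl⟩ := hψ.exists_eq_trigPoly
  rw [abs_of_pos (inv_pos.2 hh)] at hS
  have hne : S.Nonempty := by
    rw [Finset.nonempty_iff_ne_empty]
    rintro rfl
    simpa [trigPoly_apply] using hψ.normalized
  obtain ⟨y, hy⟩ := exists_sphere_eq_smul_toEuc hh hS hne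
  exact ⟨S, c, y, hS, rfl, hψ.normalized, hy⟩

end ClusterMeasure

section SemiclassicalLimit

variable {n : ℕ} {h : ℕ → ℝ} {ψ : ℕ → Torus n → ℂ}

lemma tendsto_wigner_sub_integral_clusterMeasure (hh : ∀ j, 0 < h j)
    {S : ℕ → Finset (Fin n → ℤ)} {c : ℕ → (Fin n → ℤ) → ℂ}
    {y : ℕ → (Fin n → ℤ) → Metric.sphere (0 : Euc n) 1} {κ : ℕ → (Fin n → ℤ) → Fin n → ℤ}
    {D : ℕ → ℝ} (hc : ∀ N, ∫ x, ‖trigPoly (S N) (c N) x‖ ^ 2 = 1)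
    (hy : ∀ N, ∀ k ∈ S N, (y N k : Euc n) = h N • toEuc k)
    (hκ : ∀ N : ℕ, IsClustering (Near (N : ℝ)) (S N) (κ N))
    (hD : ∀ N, ∀ k ∈ S N, dist (toEuc k) (toEuc (κ N k)) ≤ D N)
    (hδ : ∀ N : ℕ, h N * D N ≤ 1 / ((N : ℝ) + 1)) {a : Cotangent n → ℂ}
    (ha : a ∈ TestFunctions n) :
    Tendsto (fun N => wigner (h N) (trigPoly (S N) (c N)) a -
      ∫ z, a (cosphereIncl z) ∂clusterMeasure (S N) (κ N) (c N) (y N)) atTop (𝓝 0) := by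
  have := continuous_symbol ha
  obtain ⟨b, hb0, hb, hblim, hclose, hfar⟩ := exists_summable_bounds_symCoeff ha
  have hcoeff : ∀ N, ∑ k ∈ S N, ‖c N k‖ ^ 2 = ((2 * Real.pi) ^ n)⁻¹ := fun N =>
    eq_inv_of_mul_eq_one_right ((integral_norm_sq_trigPoly (S N) (c N)).symm.trans (hc N))
  have hmeasure : ∀ N, ∫ z, a (cosphereIncl z) ∂clusterMeasure (S N) (κ N) (c N) (y N) =
      ∑ q ∈ (S N).image (κ N), ∫ x, a (x, h N • toEuc q) *
        (‖trigPoly (cluster (S N) (κ N) q) (c N) x‖ : ℂ) ^ 2 := fun N => by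
    rw [integral_clusterMeasure (by fun_prop)]
    refine Finset.sum_congr rfl fun q hq => ?_
    obtain ⟨k, hk, rfl⟩ := Finset.mem_image.1 hq
    simp only [cosphereIncl, hy N _ ((hκ N).mem k hk), Complex.real_smul, Complex.ofReal_pow,
      mul_comm]
  refine squeeze_zero_norm (fun N => ?_) (by simpa using hblim.const_mul ((2 * Real.pi) ^ n)⁻¹)
  rw [hmeasure, ← hcoeff N]
  exact norm_wigner_sub_sum_cluster_le (hh N) ha (hb0 N) (hb N) (hclose N) (hfar N)
    (hκ N).eq_of_rel (hD N) (hδ N) (c N)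

theorem exists_measures_tendsto_wigner_sub (hh : ∀ j, 0 < h j) (hlim : Tendsto h atTop (𝓝 0))
    (hψ : ∀ j, IsNormalizedEigenfunction (h j)⁻¹ (ψ j)) {χ : C(Torus n, ℝ)} {C : ℝ}
    (hC : IsObservabilityConstant χ C) :
    ∃ (j : ℕ → ℕ) (m : ℕ → ProbabilityMeasure (Cosphere n)), Tendsto j atTop atTop ∧
      (∀ N, C ≤ ∫ z, χ z.1 ∂(m N : Measure (Cosphere n))) ∧
      ∀ a ∈ TestFunctions n, Tendsto (fun N => wigner (h (j N)) (ψ (j N)) a -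
        ∫ z, a (cosphereIncl z) ∂(m N : Measure (Cosphere n))) atTop (𝓝 0) := by
  choose S c y hS hψS hc hy using fun j => (hψ j).exists_eq_trigPoly_of_inv (hh j)
  choose D hD using fun N : ℕ => exists_dist_le_of_linked n (N : ℝ)
  have hj : ∀ N : ℕ, ∃ j, N ≤ j ∧ h j * D N ≤ 1 / ((N : ℝ) + 1) := fun N => by
    have hsmall : Tendsto (fun j => h j * D N) atTop (𝓝 0) := by
      simpa using hlim.mul_const (D N)
    exact ((eventually_ge_atTop N).and (hsmall.eventually_le_const (by positivity))).exists
  choose j hjN hjD using hj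
  choose κ hκ using fun N : ℕ => exists_isClustering (Near.symm (M := (N : ℝ))) (S (j N))
  have hdiam : ∀ N, ∀ k ∈ S (j N), dist (toEuc k) (toEuc (κ N k)) ≤ D N := fun N k hk =>
    hD N _ _ ((hκ N).linked k hk) (fun l hl => hS (j N) l (cluster_subset _ _ _ hl))
      k (mem_cluster.2 ⟨hk, rfl⟩) _ ((hκ N).label_mem_cluster hk)
  refine ⟨j, fun N => ⟨clusterMeasure (S (j N)) (κ N) (c (j N)) (y (j N)),
    isProbabilityMeasure_clusterMeasure (hc (j N))⟩, tendsto_atTop_mono hjN tendsto_id,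
    fun N => hC.le_integral_clusterMeasure (hS (j N)) (hc (j N)), fun a ha => ?_⟩
  simp only [hψS]
  exact tendsto_wigner_sub_integral_clusterMeasure (fun N => hh (j N)) (fun N => hc (j N))
    (fun N => hy (j N)) hκ hdiam hjD ha

lemma represents_map_cosphereIncl {m : Measure (Cosphere n)} [IsProbabilityMeasure m]
    {μ : TestFunctions n →ₗ[ℂ] ℂ}
    (hμ : ∀ a : TestFunctions n, μ a = ∫ z, (a : Cotangent n → ℂ) (cosphereIncl z) ∂m) :
    Represents (m.map cosphereIncl) μ where
  probability := Measure.isProbabilityMeasure_map continuous_cosphereIncl.aemeasurable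
  carried := by
    rw [Measure.map_apply continuous_cosphereIncl.measurable
      (MeasurableSet.univ.prod Metric.isClosed_sphere.measurableSet).compl]
    convert measure_empty (μ := m)
    ext z
    simp [cosphereIncl]
  integral_eq a := by
    rw [hμ, integral_map continuous_cosphereIncl.aemeasurable
      (continuous_symbol a.2).aestronglyMeasurable]

lemma ofReal_le_map_cosphereIncl {m : Measure (Cosphere n)} [IsFiniteMeasure m]
    {U : Set (Torus n)} (hU : IsOpen U) {χ : C(Torus n, ℝ)} (hχ : ∀ x, χ x ≤ U.indicator 1 x)
    {C : ℝ} (hC : C ≤ ∫ z, χ z.1 ∂m) :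
    ENNReal.ofReal C ≤ m.map cosphereIncl (U ×ˢ Metric.sphere (0 : Euc n) 1) := by
  have hpre : cosphereIncl ⁻¹' (U ×ˢ Metric.sphere (0 : Euc n) 1) =
      (Prod.fst ⁻¹' U : Set (Cosphere n)) := by
    ext z
    simp [cosphereIncl]
  have hmeas : MeasurableSet (Prod.fst ⁻¹' U : Set (Cosphere n)) :=
    (hU.preimage continuous_fst).measurableSet
  rw [Measure.map_apply continuous_cosphereIncl.measurable
    (hU.measurableSet.prod Metric.isClosed_sphere.measurableSet), hpre]
  refine ENNReal.ofReal_le_of_le_toReal (hC.trans ?_)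
  rw [← measureReal_def, ← integral_indicator_one hmeas]
  exact integral_mono (integrable_of_continuous_cosphere (by fun_prop))
    ((integrable_const (1 : ℝ)).indicator hmeas) fun z => hχ z.1

theorem exists_represents_of_mem_semiclassicalMeasures {χ : C(Torus n, ℝ)} {C : ℝ}
    (hC : IsObservabilityConstant χ C) {μ : TestFunctions n →ₗ[ℂ] ℂ}
    (hμ : μ ∈ semiclassicalMeasures n) :
    ∃ m : ProbabilityMeasure (Cosphere n), C ≤ ∫ z, χ z.1 ∂(m : Measure (Cosphere n)) ∧
      Represents ((m : Measure (Cosphere n)).map cosphereIncl) μ := by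
  obtain ⟨-, h, ψ, hh, hlim, hψ, hwigner⟩ := hμ
  obtain ⟨j, m, hj, hmass, hasymp⟩ := exists_measures_tendsto_wigner_sub hh hlim hψ hC
  obtain ⟨m', hm'⟩ := exists_clusterPt_of_compactSpace (map m atTop)
  obtain ⟨V, hV, hVm⟩ := mapClusterPt_iff_ultrafilter.1 hm'
  have hreal := (ProbabilityMeasure.tendsto_iff_forall_integral_rclike_tendsto ℝ).1 hVm
  have hcomplex := (ProbabilityMeasure.tendsto_iff_forall_integral_rclike_tendsto ℂ).1 hVm
  refine ⟨m', ?_, represents_map_cosphereIncl fun a => ?_⟩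
  · exact ge_of_tendsto (hreal (.mkOfCompact ⟨fun z => χ z.1, by fun_prop⟩)) (.of_forall hmass)
  · have := continuous_symbol a.2
    have hlimit := (((hwigner a).comp hj).mono_left hV).sub ((hasymp a a.2).mono_left hV)
    simp only [Function.comp_apply, sub_sub_cancel, sub_zero] at hlimit
    exact tendsto_nhds_unique hlimit (hcomplex (.mkOfCompact
      ⟨fun z => (a : Cotangent n → ℂ) (cosphereIncl z), by fun_prop⟩))

end SemiclassicalLimit

end FlatTorus

end

theorem theoremt_general {n : ℕ} {U : Set (FlatTorus.Torus n)} (hU : IsOpen U)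
    (hne : U.Nonempty) :
    ∃ c : ℝ, 0 < c ∧
      (∀ (lam : ℝ) (ψ : FlatTorus.Torus n → ℂ), FlatTorus.IsNormalizedEigenfunction lam ψ →
        c ≤ ∫ x in U, ‖ψ x‖ ^ 2) ∧
      ∀ μ ∈ FlatTorus.semiclassicalMeasures n,
        ∃ m : Measure (FlatTorus.Cotangent n), FlatTorus.Represents m μ ∧
          ENNReal.ofReal c ≤ m (U ×ˢ Metric.sphere (0 : FlatTorus.Euc n) 1) := by
  obtain ⟨χ, h0, hχU, hχ⟩ := FlatTorus.exists_continuous_le_indicator hU hne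
  obtain ⟨c, hc, hobs⟩ := FlatTorus.exists_isObservabilityConstant h0 hχ
  refine ⟨c, hc, fun lam ψ hψ => ?_, fun μ hμ => ?_⟩
  · exact (hobs.le_integral_mul_norm_sq hψ).trans
      (FlatTorus.integral_mul_norm_sq_le_setIntegral hU hχU hψ.continuous)
  · obtain ⟨m, hm, hrep⟩ := FlatTorus.exists_represents_of_mem_semiclassicalMeasures hobs hμ
    exact ⟨_, hrep, FlatTorus.ofReal_le_map_cosphereIncl hU hχU hm⟩

theorem theoremt :
    (∀ n : ℕ, 2 ≤ n → ∀ U : Set (FlatTorus.Torus n), IsOpen U → U.Nonempty →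
      ∃ c : ℝ, 0 < c ∧ ∀ lam : ℝ, 0 ≤ lam → ∀ ψ : FlatTorus.Torus n → ℂ,
        FlatTorus.IsNormalizedEigenfunction lam ψ → c ≤ ∫ x in U, ‖ψ x‖ ^ 2) ∧
    (∀ U : Set (FlatTorus.Torus 2), IsOpen U → U.Nonempty →
      ∃ c : ℝ, 0 < c ∧ ∀ μ ∈ FlatTorus.semiclassicalMeasures 2,
        ∃ m : Measure (FlatTorus.Cotangent 2), FlatTorus.Represents m μ ∧
          ENNReal.ofReal c ≤ m (U ×ˢ Metric.sphere (0 : FlatTorus.Euc 2) 1)) :=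
  ⟨fun _ _ _ hU hne => let ⟨c, hc, h, _⟩ := theoremt_general hU hne; ⟨c, hc, fun lam _ => h lam⟩,
    fun _ hU hne => let ⟨c, hc, _, h⟩ := theoremt_general hU hne; ⟨c, hc, h⟩⟩
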